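/- **Theorem 3.3 (sensitivity of Wasserstein DRRO).** Let $\Theta\subseteq\mathbb R^d$ and $\Xi\subseteq\mathbb R^n$ be closed and convex, let $p\in(1,\infty)$ and $q=p/(p-1)$, let $\|\cdot\|$ be a norm on $\mathbb R^n$ with dual norm $\|\cdot\|_*$, and let $\mathbb P_0$ be a probability measure on $\Xi$ with $\mathbb E_{\mathbb P_0}\|X\|^p<\infty$ and $\mathbb P_0(\partial\Xi)=0$. For $\delta\ge 0$ let $B_\delta$ be the set of probability measures $\mathbb P$ on $\Xi$ with $\mathcal W_p(\mathbb P_0,\mathbb P)\le\delta$, where $\mathcal W_p(\mathbb P_0,\mathbb P)=\big(\inf_\pi\int\|x-y\|^p\,\pi(dx,dy)\big)^{1/p}$, the infimum being over the couplings $\pi$ of $\mathbb P_0$ and $\mathbb P$. For a loss $\ell:\Theta\times\Xi\to\mathbb R$ put $$R(\delta,\theta)=\sup_{\beta\in\Theta}\sup_{\mathbb P\in B_\delta}\mathbb E_{\mathbb P}[\ell(\theta,X)-\ell(\beta,X)],\qquad V(\delta)=\inf_{\theta\in\Theta}R(\delta,\theta),\qquad \Theta^*_\delta=\operatorname*{argmin}_{\theta\in\Theta}R(\delta,\theta),$$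 and let $\Theta^*=\Theta^*_0$ (the set of optimizers of the ERM problem $\min_{\theta\in\Theta}\mathbb E_{\mathbb P_0}[\ell(\theta,X)]$). Assume: 1. For every $\theta\in\Theta$ the function $\ell(\theta,\cdot)$ is differentiable on $\Xi$ (relative to $\Xi$), the map $(\theta,x)\mapsto\nabla_x\ell(\theta,x)$ is continuous on $\Theta\times\Xi$, and for every $r>0$ there is $c>0$ with $\|\nabla_x\ell(\theta,x)\|_*\le c(1+\|x\|^{p-1})$ for all $x\in\Xi$ and all $\theta\in\Theta$ with $\|\theta\|\le r$. 2. $\Theta^*_\delta\ne\emptyset$ for all sufficiently small $\delta>0$, and whenever $\delta_n>0$, $\delta_n\to0$ and $\theta_n\in\Theta^*_{\delta_n}$ for all $n$, a subsequence of $(\theta_n)$ converges to an element of $\Theta^*$. 3. For every $\theta^*\in\Theta^*$ there are points $\beta_\delta$, $\delta>0$, such that for all sufficiently small $\delta>0$ one has $\beta_\delta\in\Theta$ and the supremum over $\beta\in\Theta$ in $R(\delta,\theta^*)$ is attained at $\beta_\delta$, and such that for every sequence $\delta_n>0$ with $\delta_n\to0$ a subsequence of $(\beta_{\delta_n})$ converges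 to an element of $\Theta^*$. Then, with $S(\theta,\beta)=\big(\mathbb E_{\mathbb P_0}\big[\|\nabla_x\ell(\theta,X)-\nabla_x\ell(\beta,X)\|_*^q\big]\big)^{1/q}$, the following limits exist, are finite, and satisfy $$\lim_{\delta\downarrow0}\frac{V(\delta)-V(0)}{\delta}=\inf_{\theta^*\in\Theta^*}\sup_{\beta^*\in\Theta^*}S(\theta^*,\beta^*),$$ $$\lim_{\delta\downarrow0}\frac{R(\delta,\theta^*)-R(0,\theta^*)}{\delta}=\sup_{\beta^*\in\Theta^*}S(\theta^*,\beta^*)\qquad\text{for every }\theta^*\in\Theta^*.$$ In particular, if $\Theta^*=\{\theta^*\}$ is a singleton, then both limits are $0$, and there is no first-order gain from the DRRO strategy over the ERM strategy: $\lim_{\delta\downarrow0}\big(R(\delta,\theta^*)-V(\delta)\big)/\delta=0$. -/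

import Mathlib

open MeasureTheory Filter Topology
open scoped ENNReal

noncomputable section

namespace WDRRO

variable {E F : Type*} [NormedAddCommGroup E] [MeasurableSpace E]

/-- The probability distributions supported on `Ξ`, as Borel probability measures on the ambient
space that give no mass to the complement of `Ξ`. -/
def ProbOn (Ξ : Set E) : Set (Measure E) :=
  {P | IsProbabilityMeasure P ∧ P Ξᶜ = 0}

/-- The couplings of `P` and `Q`: joint distributions with marginals `P` and `Q`. -/
def couplings (P Q : Measure E) : Set (Measure (E × E)) :=
  {π | π.map Prod.fst = P ∧ π.map Prod.snd = Q}

/-- The type-`p` Wasserstein distance, with the norm of `E` as transport cost. -/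
def wasserstein (p : ℝ) (P Q : Measure E) : ℝ≥0∞ :=
  (⨅ π ∈ couplings P Q, ∫⁻ z, ‖z.1 - z.2‖ₑ ^ p ∂π) ^ (1 / p)

/-- The closed Wasserstein ball of radius `δ` around `P₀` in the distributions on `Ξ`. -/
def ball (Ξ : Set E) (p : ℝ) (P₀ : Measure E) (δ : ℝ) : Set (Measure E) :=
  {P | P ∈ ProbOn Ξ ∧ wasserstein p P₀ P ≤ ENNReal.ofReal δ}

/-- The worst case, over the ball of radius `δ`, of the expected excess loss of `θ` over `β`. -/
def excess (Ξ : Set E) (p : ℝ) (P₀ : Measure E) (ℓ : F → E → ℝ) (δ : ℝ) (θ β : F) : EReal :=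
  ⨆ P ∈ ball Ξ p P₀ δ, ((∫ x, (ℓ θ x - ℓ β x) ∂P : ℝ) : EReal)

/-- The regret `R(δ, θ)`, with value `⊤` when the supremum is infinite. -/
def regret (Θ : Set F) (Ξ : Set E) (p : ℝ) (P₀ : Measure E) (ℓ : F → E → ℝ)
    (δ : ℝ) (θ : F) : EReal :=
  ⨆ β ∈ Θ, excess Ξ p P₀ ℓ δ θ β

/-- The optimal regret `V(δ)`. -/
def optRegret (Θ : Set F) (Ξ : Set E) (p : ℝ) (P₀ : Measure E) (ℓ : F → E → ℝ)
    (δ : ℝ) : EReal :=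
  ⨅ θ ∈ Θ, regret Θ Ξ p P₀ ℓ δ θ

/-- The set of minimizers over `Θ` of the regret at radius `δ`. At `δ = 0` this is the set of
optimizers of the ERM problem. -/
def minimizers (Θ : Set F) (Ξ : Set E) (p : ℝ) (P₀ : Measure E) (ℓ : F → E → ℝ)
    (δ : ℝ) : Set F :=
  {θ | θ ∈ Θ ∧ ∀ θ' ∈ Θ, regret Θ Ξ p P₀ ℓ δ θ ≤ regret Θ Ξ p P₀ ℓ δ θ'}

/-- `f` has right derivative `v` at `0`, as the limit of the difference quotients. -/
def HasRightDerivAtZero (f : ℝ → EReal) (v : EReal) : Prop :=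
  Tendsto (fun δ : ℝ => (f δ - f 0) / (δ : EReal)) (𝓝[>] 0) (𝓝 v)

/-- The gradient in `x` of the loss at `(θ, x)`, as an element of the dual space of `E`; its norm
there is the dual norm. Derivatives are taken relative to `Ξ`, where the loss lives. -/
def grad [NormedSpace ℝ E] (Ξ : Set E) (ℓ : F → E → ℝ) (θ : F) (x : E) : E →L[ℝ] ℝ :=
  fderivWithin ℝ (ℓ θ) Ξ x

/-- `(𝔼_{P₀} ‖∇ₓℓ(θ, X) - ∇ₓℓ(β, X)‖_* ^ q) ^ (1 / q)`. -/
def gradDist [NormedSpace ℝ E] (Ξ : Set E) (q : ℝ) (P₀ : Measure E) (ℓ : F → E → ℝ)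
    (θ β : F) : ℝ≥0∞ :=
  (∫⁻ x, ‖grad Ξ ℓ θ x - grad Ξ ℓ β x‖ₑ ^ q ∂P₀) ^ (1 / q)

/-- The loss is differentiable in `x`, with a gradient that is jointly continuous and grows like
`1 + ‖x‖ ^ (p - 1)`, locally uniformly in the parameter. -/
def SmoothLoss [NormedSpace ℝ E] [NormedAddCommGroup F] (Θ : Set F) (Ξ : Set E) (p : ℝ)
    (ℓ : F → E → ℝ) : Prop :=
  (∀ θ ∈ Θ, DifferentiableOn ℝ (ℓ θ) Ξ) ∧
  ContinuousOn (fun z : F × E => grad Ξ ℓ z.1 z.2) (Θ ×ˢ Ξ) ∧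
  ∀ r : ℝ, 0 < r → ∃ c : ℝ, 0 < c ∧ ∀ x ∈ Ξ, ∀ θ ∈ Θ, ‖θ‖ ≤ r →
    ‖grad Ξ ℓ θ x‖ ≤ c * (1 + ‖x‖ ^ (p - 1))

/-- For small radii the regret has minimizers, and minimizers for radii tending to zero
subconverge to an ERM optimizer. -/
def MinimizersConverge [TopologicalSpace F] (Θ : Set F) (Ξ : Set E) (p : ℝ) (P₀ : Measure E)
    (ℓ : F → E → ℝ) : Prop :=
  (∀ᶠ δ in 𝓝[>] (0 : ℝ), (minimizers Θ Ξ p P₀ ℓ δ).Nonempty) ∧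
  ∀ (δ : ℕ → ℝ) (t : ℕ → F), (∀ n, 0 < δ n) → Tendsto δ atTop (𝓝 0) →
    (∀ n, t n ∈ minimizers Θ Ξ p P₀ ℓ (δ n)) →
    ∃ φ : ℕ → ℕ, StrictMono φ ∧ ∃ θ ∈ minimizers Θ Ξ p P₀ ℓ 0,
      Tendsto (fun n => t (φ n)) atTop (𝓝 θ)

/-- For every ERM optimizer `θ`, the supremum over `β` that defines its regret is attained for
small `δ > 0`, at some `b δ`, and these maximizers subconverge to an ERM optimizer as `δ` tends
to zero. -/
def MaximizersConverge [TopologicalSpace F] (Θ : Set F) (Ξ : Set E) (p : ℝ) (P₀ : Measure E)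
    (ℓ : F → E → ℝ) : Prop :=
  ∀ θ ∈ minimizers Θ Ξ p P₀ ℓ 0, ∃ b : ℝ → F,
    (∀ᶠ δ in 𝓝[>] (0 : ℝ), b δ ∈ Θ ∧
      excess Ξ p P₀ ℓ δ θ (b δ) = regret Θ Ξ p P₀ ℓ δ θ) ∧
    ∀ δ : ℕ → ℝ, (∀ n, 0 < δ n) → Tendsto δ atTop (𝓝 0) →
      ∃ φ : ℕ → ℕ, StrictMono φ ∧ ∃ β ∈ minimizers Θ Ξ p P₀ ℓ 0,
        Tendsto (fun n => b (δ (φ n))) atTop (𝓝 β)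

end WDRRO

end

namespace WDRRO

/-! For fixed parameters, the worst-case excess loss over the ball of radius `δ` is `𝔼_{P₀}[ℓ θ - ℓ
β] + δ S(θ, β) + o(δ)`, in the one-sided, locally uniform sense of `FirstOrderExpansion`.

Upper bound (`exists_integral_le_of_gradDist_lt`): along a coupling of cost about `δ`, the mean
value inequality bounds the change of `ℓ θ - ℓ β` by the gradient difference at the starting point
times the displacement, plus small errors. Hölder's inequality under the coupling gives the slope
`S`.

Lower bound (`exists_integral_ge_of_lt_gradDist`): push `P₀` forward by `x ↦ x + δ v(x)`, where `v`
nearly attains the `L^p`-`L^q` duality for the gradient difference. As `P₀` charges only the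
interior of `Ξ`, `v` can be supported in a compact subset of it, so the transport stays in `Ξ`.

The rest is an envelope argument. ERM optimizers have regret `0` at radius `0`. For such `θ`, the
maximizers `β_δ` subconverge to some ERM optimizer `β`, and the zeroth-order term `𝔼[ℓ θ - ℓ β_δ]`
is nonpositive, so the regret grows at most at rate `S(θ, β)`; testing against any ERM optimizer
gives the matching lower bound. For `V`, the minimizers `θ_δ` subconverge to an ERM optimizer `θ`,
and testing their regret against an ERM optimizer `β` leaves a nonnegative zeroth-order term, hence
a rate of at least `S(θ, β)`. -/

lemma ae_mem_of_mem_probOn {E : Type*} [MeasurableSpace E] {Ξ : Set E} {P : Measure E}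
    (hP : P ∈ ProbOn Ξ) : ∀ᵐ x ∂P, x ∈ Ξ :=
  mem_ae_iff.2 hP.2

lemma nonempty_of_mem_probOn {E : Type*} [MeasurableSpace E] {Ξ : Set E} {P : Measure E}
    (hP : P ∈ ProbOn Ξ) : Ξ.Nonempty := by
  have := hP.1
  exact (ae_mem_of_mem_probOn hP).exists

variable {E : Type*} [NormedAddCommGroup E] [NormedSpace ℝ E]
  {F : Type*} {Θ : Set F} {Ξ : Set E} {p : ℝ} {ℓ : F → E → ℝ}

/-! ### Pointwise estimates on gradients and loss increments -/

section Deterministic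

/-- Mean value inequality for the loss difference minus a linear map. The upper bound uses `φ = 0`,
the lower bound takes `φ` to be the limit gradient difference. -/
lemma abs_loss_sub_le_of_segment (hd : ∀ θ ∈ Θ, DifferentiableOn ℝ (ℓ θ) Ξ)
    (hΞ : Convex ℝ Ξ) {θ β : F} (hθ : θ ∈ Θ) (hβ : β ∈ Θ) {x y : E} (hx : x ∈ Ξ) (hy : y ∈ Ξ)
    {C : ℝ} {φ : E →L[ℝ] ℝ}
    (h : ∀ z ∈ segment ℝ x y, ‖grad Ξ ℓ θ z - grad Ξ ℓ β z - φ‖ ≤ C) :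
    |(ℓ θ y - ℓ β y) - (ℓ θ x - ℓ β x) - φ (y - x)| ≤ C * ‖y - x‖ := by
  have hs : segment ℝ x y ⊆ Ξ := hΞ.segment_subset hx hy
  exact Convex.norm_image_sub_le_of_norm_hasFDerivWithin_le' (𝕜 := ℝ)
    (f := fun x => ℓ θ x - ℓ β x) (f' := fun x => grad Ξ ℓ θ x - grad Ξ ℓ β x)
    (fun z hz => (((hd θ hθ z (hs hz)).hasFDerivWithinAt.sub
      (hd β hβ z (hs hz)).hasFDerivWithinAt).mono hs)) h (convex_segment x y)
    (left_mem_segment ℝ x y) (right_mem_segment ℝ x y)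

variable [NormedAddCommGroup F]

/-- Uniform continuity around `K`, not only on it: compactness is needed of the base points `x`,
while `z` may leave `K`. -/
lemma exists_dist_grad_lt
    (hc : ContinuousOn (fun z : F × E => grad Ξ ℓ z.1 z.2) (Θ ×ˢ Ξ))
    {K : Set E} (hK : IsCompact K) (hKΞ : K ⊆ Ξ) {θ : F} (hθ : θ ∈ Θ) {ε : ℝ} (hε : 0 < ε) :
    ∃ r > 0, ∀ θ' ∈ Θ, dist θ' θ < r → ∀ x ∈ K, ∀ z ∈ Ξ, dist z x < r →
      dist (grad Ξ ℓ θ' z) (grad Ξ ℓ θ x) < ε := by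
  -- Writing `z = x + u.2` turns the claim into one about a neighbourhood of `(θ, 0)` common to all
  -- `x ∈ K`, which compactness yields from local statements.
  have key : ∀ᶠ u : F × E in 𝓝 (θ, 0), ∀ x ∈ K, u.1 ∈ Θ → x + u.2 ∈ Ξ → x ∈ Ξ →
      dist (grad Ξ ℓ u.1 (x + u.2)) (grad Ξ ℓ θ x) < ε := by
    refine hK.eventually_forall_of_forall_eventually
      (P := fun (u : F × E) (x : E) => u.1 ∈ Θ → x + u.2 ∈ Ξ → x ∈ Ξ →
        dist (grad Ξ ℓ u.1 (x + u.2)) (grad Ξ ℓ θ x) < ε) fun y hy => ?_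
    have h0 : ∀ᶠ w : F × E in 𝓝 (θ, y), w ∈ Θ ×ˢ Ξ →
        dist (grad Ξ ℓ w.1 w.2) (grad Ξ ℓ θ y) < ε / 2 :=
      eventually_nhdsWithin_iff.1
        ((hc (θ, y) ⟨hθ, hKΞ hy⟩).eventually (Metric.ball_mem_nhds _ (half_pos hε)))
    have t1 : Tendsto (fun z : (F × E) × E => (z.1.1, z.2 + z.1.2)) (𝓝 ((θ, 0), y))
        (𝓝 (θ, y)) := by
      have : Continuous (fun z : (F × E) × E => (z.1.1, z.2 + z.1.2)) := by fun_prop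
      simpa using this.tendsto ((θ, (0 : E)), y)
    have t2 : Tendsto (fun z : (F × E) × E => (θ, z.2)) (𝓝 ((θ, 0), y)) (𝓝 (θ, y)) := by
      have : Continuous (fun z : (F × E) × E => (θ, z.2)) := by fun_prop
      simpa using this.tendsto ((θ, (0 : E)), y)
    filter_upwards [t1.eventually h0, t2.eventually h0] with z h1 h2 hz hz' hz''
    have a := h1 ⟨hz, hz'⟩
    have b := h2 ⟨hθ, hz''⟩
    have := dist_triangle_right (grad Ξ ℓ z.1.1 (z.2 + z.1.2)) (grad Ξ ℓ θ z.2) (grad Ξ ℓ θ y)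
    linarith
  obtain ⟨r, hr, h⟩ := Metric.eventually_nhds_iff.1 key
  refine ⟨r, hr, fun θ' hθ' hd x hx z hz hzx => ?_⟩
  have := h (y := (θ', z - x)) (by
    rw [Prod.dist_eq]; exact max_lt hd (by simpa [dist_eq_norm] using hzx)) x hx hθ'
    (by simpa using hz) (hKΞ hx)
  simpa using this

lemma exists_norm_grad_sub_sub_le
    (hc : ContinuousOn (fun z : F × E => grad Ξ ℓ z.1 z.2) (Θ ×ˢ Ξ))
    {K : Set E} (hK : IsCompact K) (hKΞ : K ⊆ Ξ) {θ β : F} (hθ : θ ∈ Θ) (hβ : β ∈ Θ)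
    {ε : ℝ} (hε : 0 < ε) :
    ∃ r > 0, ∀ θ' ∈ Θ, dist θ' θ < r → ∀ β' ∈ Θ, dist β' β < r →
      ∀ x ∈ K, ∀ z ∈ Ξ, dist z x < r →
      ‖(grad Ξ ℓ θ' z - grad Ξ ℓ β' z) - (grad Ξ ℓ θ x - grad Ξ ℓ β x)‖ ≤ ε := by
  obtain ⟨r₁, hr₁, h₁⟩ := exists_dist_grad_lt hc hK hKΞ hθ (half_pos hε)
  obtain ⟨r₂, hr₂, h₂⟩ := exists_dist_grad_lt hc hK hKΞ hβ (half_pos hε)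
  refine ⟨min r₁ r₂, lt_min hr₁ hr₂, fun θ' hθ' hd β' hβ' hd' x hx z hz hzx => ?_⟩
  have a := h₁ θ' hθ' (hd.trans_le (min_le_left _ _)) x hx z hz (hzx.trans_le (min_le_left _ _))
  have b := h₂ β' hβ' (hd'.trans_le (min_le_right _ _)) x hx z hz
    (hzx.trans_le (min_le_right _ _))
  rw [dist_eq_norm] at a b
  rw [sub_sub_sub_comm]
  exact (norm_sub_le _ _).trans (by linarith)

lemma exists_norm_grad_sub_le
    (hg : ∀ r : ℝ, 0 < r → ∃ c : ℝ, 0 < c ∧ ∀ x ∈ Ξ, ∀ θ ∈ Θ, ‖θ‖ ≤ r →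
      ‖grad Ξ ℓ θ x‖ ≤ c * (1 + ‖x‖ ^ (p - 1))) (θ β : F) :
    ∃ c : ℝ, 0 < c ∧ ∀ θ' ∈ Θ, dist θ' θ < 1 → ∀ β' ∈ Θ, dist β' β < 1 → ∀ x ∈ Ξ,
      ‖grad Ξ ℓ θ' x - grad Ξ ℓ β' x‖ ≤ c * (1 + ‖x‖ ^ (p - 1)) := by
  obtain ⟨c, hc, h⟩ := hg (‖θ‖ + ‖β‖ + 1) (by positivity)
  refine ⟨2 * c, by positivity, fun θ' hθ' hd β' hβ' hd' x hx => ?_⟩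
  have n1 : ‖θ'‖ ≤ ‖θ‖ + ‖β‖ + 1 := by
    have := norm_le_norm_add_norm_sub' θ' θ
    rw [dist_eq_norm] at hd
    have := norm_nonneg β
    linarith
  have n2 : ‖β'‖ ≤ ‖θ‖ + ‖β‖ + 1 := by
    have := norm_le_norm_add_norm_sub' β' β
    rw [dist_eq_norm] at hd'
    have := norm_nonneg θ
    linarith
  have a := h x hx θ' hθ' n1
  have b := h x hx β' hβ' n2
  exact (norm_sub_le _ _).trans (by linarith)

lemma add_rpow_le_two_mul {a b s : ℝ} (ha : 0 ≤ a) (hb : 0 ≤ b) (hs : 0 ≤ s) :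
    (a + b) ^ s ≤ 2 ^ s * (a ^ s + b ^ s) := by
  have h1 : a + b ≤ 2 * max a b := by
    have := le_max_left a b
    have := le_max_right a b
    linarith
  have hm : 0 ≤ max a b := ha.trans (le_max_left _ _)
  calc (a + b) ^ s ≤ (2 * max a b) ^ s := Real.rpow_le_rpow (by positivity) h1 hs
    _ = 2 ^ s * (max a b) ^ s := Real.mul_rpow (by norm_num) hm
    _ ≤ 2 ^ s * (a ^ s + b ^ s) := by
      gcongr
      have := Real.rpow_nonneg ha s
      have := Real.rpow_nonneg hb s
      rcases max_choice a b with h | h <;> rw [h] <;> linarith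

/-- Near a compact set the gradients are close to the limit gradient, and the growth bound
controls the rest. -/
lemma exists_norm_grad_sub_le_add (hp : 1 < p)
    (hc : ContinuousOn (fun z : F × E => grad Ξ ℓ z.1 z.2) (Θ ×ˢ Ξ))
    {θ β : F} (hθ : θ ∈ Θ) (hβ : β ∈ Θ) {c : ℝ} (hcpos : 0 < c)
    (hg : ∀ θ' ∈ Θ, dist θ' θ < 1 → ∀ β' ∈ Θ, dist β' β < 1 → ∀ x ∈ Ξ,
      ‖grad Ξ ℓ θ' x - grad Ξ ℓ β' x‖ ≤ c * (1 + ‖x‖ ^ (p - 1)))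
    {K : Set E} (hK : IsCompact K) (hKΞ : K ⊆ Ξ) {ε : ℝ} (hε : 0 < ε) :
    ∃ r > 0, ∃ C ≥ 0, ∀ θ' ∈ Θ, dist θ' θ < r → ∀ β' ∈ Θ, dist β' β < r →
      ∀ x ∈ Ξ, ∀ z ∈ Ξ, ‖grad Ξ ℓ θ' z - grad Ξ ℓ β' z‖ ≤
        ‖grad Ξ ℓ θ x - grad Ξ ℓ β x‖ + ε +
          Kᶜ.indicator (fun x => c * 2 ^ (p - 1) * (1 + ‖x‖ ^ (p - 1))) x +
          C * ‖z - x‖ ^ (p - 1) := by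
  have hp1 : 0 ≤ p - 1 := by linarith
  obtain ⟨r, hr, h⟩ := exists_norm_grad_sub_sub_le hc hK hKΞ hθ hβ hε
  obtain ⟨A, hA⟩ := hK.isBounded.exists_norm_le
  set B : ℝ := c * 2 ^ (p - 1) with hB
  have hBpos : 0 < B := by positivity
  have hη : 0 < r ^ (p - 1) := Real.rpow_pos_of_pos hr _
  have h2 : (1 : ℝ) ≤ 2 ^ (p - 1) := Real.one_le_rpow (by norm_num) hp1
  have hA' : 0 ≤ 1 + |A| ^ (p - 1) := by positivity
  -- The first `B` in `C` comes from the growth bound. The second term serves `x ∈ K` with `‖z - x‖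
  -- ≥ r`, where the bounded quantity `B * (1 + ‖x‖ ^ (p - 1))` is absorbed into a multiple of `‖z -
  -- x‖ ^ (p - 1)`.
  refine ⟨min r 1, lt_min hr one_pos, B + B * (1 + |A| ^ (p - 1)) / r ^ (p - 1), by positivity,
    fun θ' hθ' hd β' hβ' hd' x hx z hz => ?_⟩
  have hzx : 0 ≤ ‖z - x‖ ^ (p - 1) := by positivity
  have hX : 0 ≤ ‖x‖ ^ (p - 1) := by positivity
  have grow : ‖grad Ξ ℓ θ' z - grad Ξ ℓ β' z‖ ≤
      B * (1 + ‖x‖ ^ (p - 1)) + B * ‖z - x‖ ^ (p - 1) := by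
    refine (hg θ' hθ' (hd.trans_le (min_le_right _ _)) β' hβ'
      (hd'.trans_le (min_le_right _ _)) z hz).trans ?_
    have : ‖z‖ ^ (p - 1) ≤ 2 ^ (p - 1) * (‖x‖ ^ (p - 1) + ‖z - x‖ ^ (p - 1)) :=
      (Real.rpow_le_rpow (norm_nonneg _) (norm_le_norm_add_norm_sub' z x) hp1).trans
        (add_rpow_le_two_mul (norm_nonneg _) (norm_nonneg _) hp1)
    calc c * (1 + ‖z‖ ^ (p - 1))
        ≤ c * (2 ^ (p - 1) + 2 ^ (p - 1) * (‖x‖ ^ (p - 1) + ‖z - x‖ ^ (p - 1))) := by gcongr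
      _ = _ := by rw [hB]; ring
  have hD : 0 ≤ B * (1 + |A| ^ (p - 1)) / r ^ (p - 1) := by positivity
  by_cases hxK : x ∈ K
  · rw [Set.indicator_of_notMem (by simpa using hxK), add_zero]
    by_cases hr' : dist z x < r
    · have := h θ' hθ' (hd.trans_le (min_le_left _ _)) β' hβ' (hd'.trans_le (min_le_left _ _))
        x hxK z hz hr'
      have t := norm_le_norm_add_norm_sub' (grad Ξ ℓ θ' z - grad Ξ ℓ β' z)
        (grad Ξ ℓ θ x - grad Ξ ℓ β x)
      have := mul_nonneg (add_nonneg hBpos.le hD) hzx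
      linarith
    · rw [not_lt, dist_eq_norm] at hr'
      have h3 : r ^ (p - 1) ≤ ‖z - x‖ ^ (p - 1) := Real.rpow_le_rpow hr.le hr' hp1
      have h4 : ‖x‖ ^ (p - 1) ≤ |A| ^ (p - 1) :=
        Real.rpow_le_rpow (norm_nonneg _) ((hA x hxK).trans (le_abs_self A)) hp1
      have h5 : B * (1 + ‖x‖ ^ (p - 1)) ≤
          B * (1 + |A| ^ (p - 1)) / r ^ (p - 1) * ‖z - x‖ ^ (p - 1) := by
        rw [div_mul_eq_mul_div, le_div_iff₀ hη]
        gcongr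
      have := norm_nonneg (grad Ξ ℓ θ x - grad Ξ ℓ β x)
      rw [add_mul]
      linarith
  · rw [Set.indicator_of_mem (by simpa using hxK), add_mul]
    have := norm_nonneg (grad Ξ ℓ θ x - grad Ξ ℓ β x)
    have := mul_nonneg hD hzx
    linarith

lemma SmoothLoss.continuousOn_grad (h₁ : SmoothLoss Θ Ξ p ℓ) {θ : F} (hθ : θ ∈ Θ) :
    ContinuousOn (grad Ξ ℓ θ) Ξ :=
  h₁.2.1.comp (f := fun x : E => (θ, x)) (by fun_prop) fun _ hx => ⟨hθ, hx⟩

lemma SmoothLoss.continuousOn_grad_sub (h₁ : SmoothLoss Θ Ξ p ℓ) {θ β : F} (hθ : θ ∈ Θ)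
    (hβ : β ∈ Θ) : ContinuousOn (fun x => grad Ξ ℓ θ x - grad Ξ ℓ β x) Ξ :=
  (h₁.continuousOn_grad hθ).sub (h₁.continuousOn_grad hβ)

end Deterministic

/-! ### Integrability of losses and moments of coupled measures -/

section Integrability

variable [NormedAddCommGroup F] [MeasurableSpace E]

variable [BorelSpace E] [FiniteDimensional ℝ E]

lemma aestronglyMeasurable_of_continuousOn {H : Type*} [TopologicalSpace H]
    [TopologicalSpace.PseudoMetrizableSpace H] {f : E → H} {P : Measure E}
    (hP : P ∈ ProbOn Ξ) (hΞ : IsClosed Ξ) (hf : ContinuousOn f Ξ) : AEStronglyMeasurable f P := by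
  have : ProperSpace E := FiniteDimensional.proper_real E
  have := hf.aestronglyMeasurable (μ := P) hΞ.measurableSet
  rwa [Measure.restrict_eq_self_of_ae_mem (ae_mem_of_mem_probOn hP)] at this

/-- Integrating the gradient growth from a base point `x₀` bounds the loss by a multiple of `(1 +
‖x₀‖ + ‖x‖) ^ p` plus a constant. -/
lemma integrable_loss (hp : 1 < p) (hΞc : IsClosed Ξ) (hΞ : Convex ℝ Ξ)
    (h₁ : SmoothLoss Θ Ξ p ℓ) {P : Measure E} (hP : P ∈ ProbOn Ξ)
    (hm : MemLp (fun x => x) (ENNReal.ofReal p) P) {θ : F} (hθ : θ ∈ Θ) :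
    Integrable (ℓ θ) P := by
  have := hP.1
  have hp0 : 0 < p := by linarith
  have hp1 : 0 ≤ p - 1 := by linarith
  obtain ⟨x₀, hx₀⟩ := nonempty_of_mem_probOn hP
  obtain ⟨c, hc, hg⟩ := h₁.2.2 (‖θ‖ + 1) (by positivity)
  have hu : Integrable (fun x : E => (1 + ‖x₀‖ + ‖x‖) ^ p) P := by
    have : MemLp (fun x : E => 1 + ‖x₀‖ + ‖x‖) (ENNReal.ofReal p) P :=
      (memLp_const (1 + ‖x₀‖)).add hm.norm
    have h := this.integrable_norm_rpow (by simpa using hp0) ENNReal.ofReal_ne_top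
    rw [ENNReal.toReal_ofReal hp0.le] at h
    refine h.congr (Eventually.of_forall fun x => ?_)
    simp only [Real.norm_eq_abs]
    rw [abs_of_nonneg (by positivity)]
  refine Integrable.mono' ((hu.const_mul (2 * c)).add (integrable_const |ℓ θ x₀|))
    (aestronglyMeasurable_of_continuousOn hP hΞc (h₁.1 θ hθ).continuousOn) ?_
  filter_upwards [(ae_mem_of_mem_probOn hP)] with x hx
  have hs := hΞ.segment_subset hx₀ hx
  have hu1 : 1 ≤ 1 + ‖x₀‖ + ‖x‖ := by
    have := norm_nonneg x; have := norm_nonneg x₀; linarith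
  have hmv : ‖ℓ θ x - ℓ θ x₀‖ ≤ (c * (2 * (1 + ‖x₀‖ + ‖x‖) ^ (p - 1))) * ‖x - x₀‖ := by
    refine Convex.norm_image_sub_le_of_norm_hasFDerivWithin_le (𝕜 := ℝ)
      (f' := fun x => grad Ξ ℓ θ x)
      (fun z hz => ((h₁.1 θ hθ z (hs hz)).hasFDerivWithinAt.mono hs)) (fun z hz => ?_)
      (convex_segment x₀ x) (left_mem_segment ℝ _ _) (right_mem_segment ℝ _ _)
    refine (hg z (hs hz) θ hθ (by linarith)).trans ?_
    have hz' : ‖z‖ ≤ 1 + ‖x₀‖ + ‖x‖ := by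
      have : ‖z‖ ≤ max ‖x₀‖ ‖x‖ := by
        have := (convexOn_norm (E := E) convex_univ).le_on_segment (Set.mem_univ x₀)
          (Set.mem_univ x) hz
        exact this
      have a := norm_nonneg x
      have b := norm_nonneg x₀
      rcases max_choice ‖x₀‖ ‖x‖ with h | h <;> rw [h] at this <;> linarith
    have a1 := Real.rpow_le_rpow (norm_nonneg z) hz' hp1
    have a2 := Real.one_le_rpow hu1 hp1
    gcongr
    linarith
  have hxx : ‖x - x₀‖ ≤ 1 + ‖x₀‖ + ‖x‖ := (norm_sub_le _ _).trans (by linarith)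
  have hpow : (1 + ‖x₀‖ + ‖x‖) ^ p = (1 + ‖x₀‖ + ‖x‖) ^ (p - 1) * (1 + ‖x₀‖ + ‖x‖) := by
    rw [← Real.rpow_add_one (by positivity), sub_add_cancel]
  have h3 : (c * (2 * (1 + ‖x₀‖ + ‖x‖) ^ (p - 1))) * ‖x - x₀‖ ≤
      2 * c * (1 + ‖x₀‖ + ‖x‖) ^ p := by
    rw [hpow]
    calc _ ≤ (c * (2 * (1 + ‖x₀‖ + ‖x‖) ^ (p - 1))) * (1 + ‖x₀‖ + ‖x‖) := by gcongr
      _ = _ := by ring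
  have := norm_le_norm_add_norm_sub' (ℓ θ x) (ℓ θ x₀)
  simp only [Pi.add_apply]
  rw [Real.norm_eq_abs (ℓ θ x₀)] at this
  linarith

/-- Since `y = x - (x - y)`, finite cost passes the moment on to the other marginal. Hence the
integrals over the ball are genuine ones, not default values. -/
lemma memLp_snd_of_coupling (hp : 1 < p) {P Q : Measure E} {π : Measure (E × E)}
    (hπ : π ∈ couplings P Q) (hm : MemLp (fun x => x) (ENNReal.ofReal p) P)
    (hfin : ∫⁻ z, ‖z.1 - z.2‖ₑ ^ p ∂π < ∞) : MemLp (fun x => x) (ENNReal.ofReal p) Q := by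
  have : ProperSpace E := FiniteDimensional.proper_real E
  have hp0 : 0 < p := by linarith
  have m1 : MemLp (fun z : E × E => z.1) (ENNReal.ofReal p) π := by
    have h := hm
    rw [← hπ.1] at h
    exact (memLp_map_measure_iff (f := Prod.fst) (g := fun x : E => x)
      (by fun_prop) (by fun_prop)).1 h
  have m2 : MemLp (fun z : E × E => z.1 - z.2) (ENNReal.ofReal p) π := by
    refine ⟨by fun_prop, ?_⟩
    rw [eLpNorm_lt_top_iff_lintegral_rpow_enorm_lt_top (by simpa using hp0) ENNReal.ofReal_ne_top,
      ENNReal.toReal_ofReal hp0.le]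
    exact hfin
  rw [← hπ.2]
  refine (memLp_map_measure_iff (f := Prod.snd) (g := fun x : E => x) (by fun_prop) (by fun_prop)).2 ?_
  convert m1.sub m2 using 1
  ext z
  simp

end Integrability

end WDRRO

namespace WDRRO

variable {E : Type*} [NormedAddCommGroup E] [NormedSpace ℝ E] [FiniteDimensional ℝ E]
  [MeasurableSpace E] [BorelSpace E]
  {F : Type*} [NormedAddCommGroup F] {Θ : Set F} {Ξ : Set E} {p q : ℝ} {P₀ : Measure E}
  {ℓ : F → E → ℝ}

section Gradient

omit [FiniteDimensional ℝ E] [BorelSpace E] [NormedAddCommGroup F] in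
lemma gradDist_eq_eLpNorm (hq : 0 < q) (θ β : F) :
    gradDist Ξ q P₀ ℓ θ β =
      eLpNorm (fun x => grad Ξ ℓ θ x - grad Ξ ℓ β x) (ENNReal.ofReal q) P₀ := by
  rw [gradDist, eLpNorm_eq_lintegral_rpow_enorm_toReal (by simpa using hq) ENNReal.ofReal_ne_top,
    ENNReal.toReal_ofReal hq.le]

-- Conjugacy gives `(p - 1) * q = p`, so the `q`-th power of the growth bound has the order of the
-- `p`-th moment.
omit [NormedSpace ℝ E] [FiniteDimensional ℝ E] [BorelSpace E] in
lemma memLp_growth (hpq : p.HolderConjugate q) (hP₀ : P₀ ∈ ProbOn Ξ)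
    (hm : MemLp (fun x => x) (ENNReal.ofReal p) P₀) (c : ℝ) :
    MemLp (fun x : E => c * (1 + ‖x‖ ^ (p - 1))) (ENNReal.ofReal q) P₀ := by
  have := hP₀.1
  have hp1 : 0 < p - 1 := hpq.sub_one_pos
  have h := hm.norm_rpow_div (ENNReal.ofReal (p - 1))
  rw [ENNReal.toReal_ofReal hp1.le, ← ENNReal.ofReal_div_of_pos hp1, ← hpq.conjugate_eq] at h
  exact ((memLp_const (1 : ℝ)).add h).const_mul c

lemma gradDist_lt_top (hpq : p.HolderConjugate q) (hΞ : IsClosed Ξ) (hP₀ : P₀ ∈ ProbOn Ξ)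
    (hm : MemLp (fun x => x) (ENNReal.ofReal p) P₀) (h₁ : SmoothLoss Θ Ξ p ℓ)
    {θ β : F} (hθ : θ ∈ Θ) (hβ : β ∈ Θ) : gradDist Ξ q P₀ ℓ θ β < ⊤ := by
  rw [gradDist_eq_eLpNorm hpq.symm.pos]
  obtain ⟨c, hc, h⟩ := exists_norm_grad_sub_le h₁.2.2 θ β
  refine ((memLp_growth hpq hP₀ hm c).mono' (aestronglyMeasurable_of_continuousOn hP₀ hΞ
    (h₁.continuousOn_grad_sub hθ hβ)) ?_).2
  filter_upwards [ae_mem_of_mem_probOn hP₀] with x hx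
  exact h θ hθ (by simp) β hβ (by simp) x hx

end Gradient

/-! ### Upper bound: couplings and Hölder's inequality -/

section Upper

omit [NormedSpace ℝ E] [FiniteDimensional ℝ E] [BorelSpace E] in
lemma exists_coupling_of_wasserstein_lt (hp : 0 < p) {P Q : Measure E} {t : ℝ≥0∞}
    (h : wasserstein p P Q < t) :
    ∃ π ∈ couplings P Q, ∫⁻ z, ‖z.1 - z.2‖ₑ ^ p ∂π < t ^ p := by
  have h2 := ENNReal.rpow_lt_rpow h hp
  rw [wasserstein, ← ENNReal.rpow_mul, one_div_mul_cancel hp.ne', ENNReal.rpow_one] at h2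
  simpa only [iInf_lt_iff, exists_prop] using h2

/-- Both integrals are lifted to `π`. As `h` depends on the starting point only, its `L^q` norm
under `π` is the one under `P₀`, and Hölder pairs it with the transport cost. -/
lemma integral_sub_le_of_coupling (hpq : p.HolderConjugate q) {P : Measure E}
    (hP₀ : P₀ ∈ ProbOn Ξ) (hP : P ∈ ProbOn Ξ)
    {π : Measure (E × E)} (hπ : π ∈ couplings P₀ P) {t : ℝ} (ht : 0 ≤ t)
    (hπt : ∫⁻ z, ‖z.1 - z.2‖ₑ ^ p ∂π ≤ ENNReal.ofReal t ^ p)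
    {g h : E → ℝ} (hg₀ : Integrable g P₀) (hg : Integrable g P)
    (hh : AEStronglyMeasurable h P₀) {a C : ℝ} (ha : 0 ≤ a) (hC : 0 ≤ C)
    (hha : eLpNorm h (ENNReal.ofReal q) P₀ ≤ ENNReal.ofReal a)
    (hgh : ∀ x ∈ Ξ, ∀ y ∈ Ξ, |g y - g x| ≤ h x * ‖y - x‖ + C * ‖y - x‖ ^ p) :
    ∫ x, g x ∂P - ∫ x, g x ∂P₀ ≤ a * t + C * t ^ p := by
  have : ProperSpace E := FiniteDimensional.proper_real E
  have hp0 := hpq.pos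
  have hq0 := hpq.symm.pos
  have e1 : ∫ x, g x ∂P₀ = ∫ z, g z.1 ∂π := by
    rw [← hπ.1] at hg₀ ⊢
    exact integral_map (by fun_prop) hg₀.aestronglyMeasurable
  have e2 : ∫ x, g x ∂P = ∫ z, g z.2 ∂π := by
    rw [← hπ.2] at hg ⊢
    exact integral_map (by fun_prop) hg.aestronglyMeasurable
  have i1 : Integrable (fun z : E × E => g z.1) π := by
    rw [← hπ.1] at hg₀
    exact hg₀.comp_measurable (by fun_prop)
  have i2 : Integrable (fun z : E × E => g z.2) π := by
    rw [← hπ.2] at hg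
    exact hg.comp_measurable (by fun_prop)
  rw [e1, e2, ← integral_sub i2 i1]
  have m1 : ∀ᵐ z ∂π, z.1 ∈ Ξ := by
    have := ae_mem_of_mem_probOn hP₀
    rw [← hπ.1] at this
    exact ae_of_ae_map (by fun_prop) this
  have m2 : ∀ᵐ z ∂π, z.2 ∈ Ξ := by
    have := ae_mem_of_mem_probOn hP
    rw [← hπ.2] at this
    exact ae_of_ae_map (by fun_prop) this
  have hh' : AEStronglyMeasurable (fun z : E × E => h z.1) π := by
    rw [← hπ.1] at hh
    exact hh.comp_measurable (by fun_prop)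
  have hhπ : (∫⁻ z, ‖h z.1‖ₑ ^ q ∂π) ^ (1 / q) ≤ ENNReal.ofReal a := by
    rw [eLpNorm_eq_lintegral_rpow_enorm_toReal (by simpa using hq0) ENNReal.ofReal_ne_top,
      ENNReal.toReal_ofReal hq0.le] at hha
    refine le_trans (le_of_eq ?_) hha
    congr 1
    rw [← hπ.1] at hh ⊢
    rw [lintegral_map' (by fun_prop) (by fun_prop)]
  have hX : (∫⁻ z, ‖z.1 - z.2‖ₑ ^ p ∂π) ^ (1 / p) ≤ ENNReal.ofReal t := by
    have := ENNReal.rpow_le_rpow hπt (one_div_pos.2 hp0).le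
    rwa [← ENNReal.rpow_mul (ENNReal.ofReal t), mul_one_div_cancel hp0.ne',
      ENNReal.rpow_one] at this
  have hr : 0 ≤ a * t + C * t ^ p := by positivity
  have bound : ‖∫ z, (g z.2 - g z.1) ∂π‖ₑ ≤ ENNReal.ofReal (a * t + C * t ^ p) := by
    calc ‖∫ z, (g z.2 - g z.1) ∂π‖ₑ ≤ ∫⁻ z, ‖g z.2 - g z.1‖ₑ ∂π :=
          enorm_integral_le_lintegral_enorm _
      _ ≤ ∫⁻ z, (‖h z.1‖ₑ * ‖z.1 - z.2‖ₑ + ENNReal.ofReal C * ‖z.1 - z.2‖ₑ ^ p) ∂π := by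
          refine lintegral_mono_ae ?_
          filter_upwards [m1, m2] with z h1 h2
          have hb := hgh z.1 h1 z.2 h2
          rw [norm_sub_rev z.2 z.1] at hb
          have hb' : ‖g z.2 - g z.1‖ ≤ ‖h z.1‖ * ‖z.1 - z.2‖ + C * ‖z.1 - z.2‖ ^ p := by
            refine hb.trans ?_
            gcongr
            exact le_abs_self _
          rw [← ofReal_norm, ← ofReal_norm, ← ofReal_norm,
            ENNReal.ofReal_rpow_of_nonneg (norm_nonneg _) hp0.le,
            ← ENNReal.ofReal_mul (norm_nonneg _), ← ENNReal.ofReal_mul hC,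
            ← ENNReal.ofReal_add (by positivity) (by positivity)]
          exact ENNReal.ofReal_le_ofReal hb'
      _ = ∫⁻ z, ‖h z.1‖ₑ * ‖z.1 - z.2‖ₑ ∂π + ENNReal.ofReal C * ∫⁻ z, ‖z.1 - z.2‖ₑ ^ p ∂π := by
          rw [lintegral_add_right _ (by fun_prop), lintegral_const_mul _ (by fun_prop)]
      _ ≤ ENNReal.ofReal a * ENNReal.ofReal t + ENNReal.ofReal C * ENNReal.ofReal t ^ p := by
          gcongr
          refine (ENNReal.lintegral_mul_le_Lp_mul_Lq π hpq.symm (f := fun z => ‖h z.1‖ₑ)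
            (g := fun z => ‖z.1 - z.2‖ₑ) hh'.enorm (by fun_prop)).trans ?_
          gcongr
      _ = ENNReal.ofReal (a * t + C * t ^ p) := by
          rw [ENNReal.ofReal_rpow_of_nonneg ht hp0.le, ← ENNReal.ofReal_mul ha,
            ← ENNReal.ofReal_mul hC, ← ENNReal.ofReal_add (by positivity) (by positivity)]
  rw [← ofReal_norm, ENNReal.ofReal_le_ofReal_iff hr] at bound
  exact (le_abs_self _).trans bound

/-- To first order, the worst-case expected excess loss grows at most at the rate `gradDist`,
locally uniformly in the parameters. -/
lemma exists_integral_le_of_gradDist_lt (hpq : p.HolderConjugate q) (hΞc : IsClosed Ξ)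
    (hΞ : Convex ℝ Ξ) (hP₀ : P₀ ∈ ProbOn Ξ)
    (hm : MemLp (fun x => x) (ENNReal.ofReal p) P₀) (h₁ : SmoothLoss Θ Ξ p ℓ)
    {θ β : F} (hθ : θ ∈ Θ) (hβ : β ∈ Θ) {s : ℝ}
    (hs : gradDist Ξ q P₀ ℓ θ β < ENNReal.ofReal s) :
    ∃ r > 0, ∀ θ' ∈ Θ, dist θ' θ < r → ∀ β' ∈ Θ, dist β' β < r → ∀ δ, 0 < δ → δ < r →
      ∀ P ∈ ball Ξ p P₀ δ,
        ∫ x, (ℓ θ' x - ℓ β' x) ∂P ≤ ∫ x, (ℓ θ' x - ℓ β' x) ∂P₀ + s * δ := by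
  have : ProperSpace E := FiniteDimensional.proper_real E
  have := hP₀.1
  have hp := hpq.lt
  have hp0 := hpq.pos
  have hp1 : 0 < p - 1 := hpq.sub_one_pos
  have hq1 : 1 ≤ ENNReal.ofReal q := by simpa using hpq.symm.lt.le
  obtain ⟨σ, hσ0, hσ⟩ : ∃ σ : ℝ, 0 ≤ σ ∧ gradDist Ξ q P₀ ℓ θ β = ENNReal.ofReal σ :=
    ⟨_, ENNReal.toReal_nonneg, (ENNReal.ofReal_toReal (hs.trans_le le_top).ne).symm⟩
  have hσs : σ < s := by
    rw [hσ] at hs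
    exact (ENNReal.ofReal_lt_ofReal_iff_of_nonneg hσ0).1 hs
  -- One `ε` pays for the gradient variation near `K`, the other for the growth bound off `K`.
  obtain ⟨ε, hε, hεs⟩ : ∃ ε : ℝ, 0 < ε ∧ σ + ε + ε < s :=
    ⟨(s - σ) / 4, by linarith, by linarith⟩
  obtain ⟨c, hc, hgrow⟩ := exists_norm_grad_sub_le h₁.2.2 θ β
  have hw := memLp_growth hpq hP₀ hm (c * 2 ^ (p - 1))
  obtain ⟨η, hη, hηw⟩ := hw.eLpNorm_indicator_le hq1 ENNReal.ofReal_ne_top hε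
  obtain ⟨K, hKΞ, hK, hPK⟩ := hΞc.measurableSet.exists_isCompact_sdiff_lt (μ := P₀)
    (measure_ne_top _ _) (ε := ENNReal.ofReal η) (by simpa using hη)
  have hKc : P₀ Kᶜ ≤ ENNReal.ofReal η := by
    refine le_trans (measure_mono_ae ?_) hPK.le
    filter_upwards [ae_mem_of_mem_probOn hP₀] with x hx hxK
    exact ⟨hx, hxK⟩
  have hind := hηw Kᶜ hK.measurableSet.compl hKc
  obtain ⟨r₁, hr₁, C, hC, hb⟩ :=
    exists_norm_grad_sub_le_add hp h₁.2.1 hθ hβ hc hgrow hK hKΞ hε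
  set h : E → ℝ := fun x => ‖grad Ξ ℓ θ x - grad Ξ ℓ β x‖ + ε +
    Kᶜ.indicator (fun x => c * 2 ^ (p - 1) * (1 + ‖x‖ ^ (p - 1))) x with hh
  have hGm : AEStronglyMeasurable (fun x => grad Ξ ℓ θ x - grad Ξ ℓ β x) P₀ :=
    aestronglyMeasurable_of_continuousOn hP₀ hΞc (h₁.continuousOn_grad_sub hθ hβ)
  have hindm : AEStronglyMeasurable
      (Kᶜ.indicator (fun x : E => c * 2 ^ (p - 1) * (1 + ‖x‖ ^ (p - 1)))) P₀ :=
    hw.aestronglyMeasurable.indicator hK.measurableSet.compl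
  have hconst : AEStronglyMeasurable (fun _ : E => ε) P₀ := aestronglyMeasurable_const
  have hhm : AEStronglyMeasurable h P₀ := (hGm.norm.add hconst).add hindm
  have hha : eLpNorm h (ENNReal.ofReal q) P₀ ≤ ENNReal.ofReal (σ + ε + ε) := by
    refine (eLpNorm_add_le (hGm.norm.add hconst) hindm hq1).trans ?_
    rw [ENNReal.ofReal_add (by positivity) hε.le, ENNReal.ofReal_add hσ0 hε.le]
    refine add_le_add ((eLpNorm_add_le hGm.norm hconst hq1).trans (add_le_add ?_ ?_)) hind
    · rw [eLpNorm_norm, ← gradDist_eq_eLpNorm hpq.symm.pos, hσ]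
    · rw [eLpNorm_const _ (by simpa using hpq.symm.pos) (IsProbabilityMeasure.ne_zero P₀)]
      simp [Real.enorm_eq_ofReal hε.le]
  -- Since `p > 1`, the remainder `C * δ ^ p` is `o(δ)` and fits into the slack left below `s`.
  obtain ⟨r₂, hr₂, hr₂C⟩ : ∃ r > 0, ∀ δ : ℝ, 0 < δ → δ < r → C * δ ^ (p - 1) ≤
      s - (σ + ε + ε) := by
    have hcont : ContinuousAt (fun δ : ℝ => C * δ ^ (p - 1)) 0 :=
      (Real.continuousAt_rpow_const 0 (p - 1) (Or.inr hp1.le)).const_mul C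
    have hlim : (fun δ : ℝ => C * δ ^ (p - 1)) 0 < s - (σ + ε + ε) := by
      simp only [Real.zero_rpow hp1.ne', mul_zero]; linarith
    obtain ⟨r, hr, hr'⟩ := Metric.eventually_nhds_iff.1 (hcont.eventually_lt_const hlim)
    exact ⟨r, hr, fun δ hδ hδr => (hr' (by simpa [abs_of_pos hδ] using hδr)).le⟩
  refine ⟨min r₁ r₂, lt_min hr₁ hr₂, fun θ' hθ' hdθ β' hβ' hdβ δ hδ hδr P hP => ?_⟩
  have hmv : ∀ x ∈ Ξ, ∀ y ∈ Ξ, |(ℓ θ' y - ℓ β' y) - (ℓ θ' x - ℓ β' x)| ≤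
      h x * ‖y - x‖ + C * ‖y - x‖ ^ p := by
    intro x hx y hy
    have hpw : ‖y - x‖ ^ p = ‖y - x‖ ^ (p - 1) * ‖y - x‖ := by
      rw [← Real.rpow_add_one' (norm_nonneg _) (by simpa using hp0.ne'), sub_add_cancel]
    rw [hpw, ← mul_assoc, ← add_mul]
    have := abs_loss_sub_le_of_segment h₁.1 hΞ hθ' hβ' hx hy (φ := 0)
      (C := h x + C * ‖y - x‖ ^ (p - 1)) fun z hz => by
        rw [sub_zero]
        refine (hb θ' hθ' (hdθ.trans_le (min_le_left _ _)) β' hβ'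
          (hdβ.trans_le (min_le_left _ _)) x hx z (hΞ.segment_subset hx hy hz)).trans ?_
        gcongr
        exact norm_sub_le_of_mem_segment hz
    simpa using this
  -- An optimal coupling is not needed: each `t > δ` admits a coupling of cost below `t ^ p`, and
  -- `t` then decreases to `δ`.
  have hlim : ∀ t, δ < t → ∫ x, (ℓ θ' x - ℓ β' x) ∂P - ∫ x, (ℓ θ' x - ℓ β' x) ∂P₀ ≤
      (σ + ε + ε) * t + C * t ^ p := by
    intro t ht
    have ht0 : 0 < t := hδ.trans ht
    obtain ⟨π, hπ, hπt⟩ := exists_coupling_of_wasserstein_lt hp0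
      (hP.2.trans_lt ((ENNReal.ofReal_lt_ofReal_iff ht0).2 ht))
    have hmP := memLp_snd_of_coupling hp hπ hm (hπt.trans_le le_top)
    exact integral_sub_le_of_coupling hpq hP₀ hP.1 hπ ht0.le hπt.le
      ((integrable_loss hp hΞc hΞ h₁ hP₀ hm hθ').sub (integrable_loss hp hΞc hΞ h₁ hP₀ hm hβ'))
      ((integrable_loss hp hΞc hΞ h₁ hP.1 hmP hθ').sub
        (integrable_loss hp hΞc hΞ h₁ hP.1 hmP hβ'))
      hhm (by positivity) hC hha hmv
  have hδlim : ∫ x, (ℓ θ' x - ℓ β' x) ∂P - ∫ x, (ℓ θ' x - ℓ β' x) ∂P₀ ≤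
      (σ + ε + ε) * δ + C * δ ^ p := by
    have hcont : ContinuousAt (fun t : ℝ => (σ + ε + ε) * t + C * t ^ p) δ :=
      (continuousAt_id.const_mul _).add
        ((Real.continuousAt_rpow_const δ p (Or.inr hp0.le)).const_mul C)
    refine ge_of_tendsto (hcont.tendsto.mono_left (nhdsWithin_le_nhds (s := Set.Ioi δ))) ?_
    filter_upwards [self_mem_nhdsWithin] with t ht
    exact hlim t ht
  have hpw : δ ^ p = δ ^ (p - 1) * δ := by
    rw [← Real.rpow_add_one hδ.ne', sub_add_cancel]
  have := mul_le_mul_of_nonneg_right (hr₂C δ hδ (hδr.trans_le (min_le_right _ _))) hδ.le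
  rw [hpw, ← mul_assoc] at hδlim
  linarith

end Upper

end WDRRO

/-! ### Lower bound: almost extremal directions and transport along them -/

namespace WDRRO

variable {E : Type*} [NormedAddCommGroup E] [NormedSpace ℝ E] [FiniteDimensional ℝ E]

/-- For measurability, `Φ L` is the first term that works in a fixed dense sequence of the unit
ball; the slack `κ < 1` ensures that one exists. -/
lemma exists_measurable_almost_norming [MeasurableSpace E] {κ : ℝ}
    (hκ : κ < 1) : ∃ Φ : (E →L[ℝ] ℝ) → E, Measurable Φ ∧
      ∀ L, ‖Φ L‖ ≤ 1 ∧ κ * ‖L‖ ≤ L (Φ L) := by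
  classical
  have : ProperSpace E := FiniteDimensional.proper_real E
  have : Nonempty (Metric.closedBall (0 : E) 1) := ⟨⟨0, by simp⟩⟩
  let e : ℕ → E := fun k => (TopologicalSpace.denseSeq (Metric.closedBall (0 : E) 1) k : E)
  have he : ∀ k, ‖e k‖ ≤ 1 := fun k =>
    mem_closedBall_zero_iff.1 (TopologicalSpace.denseSeq (Metric.closedBall (0 : E) 1) k).2
  have hex : ∀ L : E →L[ℝ] ℝ, ∃ k, κ * ‖L‖ ≤ L (e k) := by
    intro L
    by_cases hL : L = 0
    · exact ⟨0, by simp [hL]⟩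
    have hlt : κ * ‖L‖ < ‖L‖ := by
      have := norm_pos_iff.2 hL
      nlinarith
    obtain ⟨x, hx1, hx⟩ := L.exists_lt_apply_of_lt_opNorm hlt
    obtain ⟨y, hy1, hy⟩ : ∃ y : E, ‖y‖ ≤ 1 ∧ κ * ‖L‖ < L y := by
      rcases abs_choice (L x) with h | h
      · exact ⟨x, hx1.le, by rwa [Real.norm_eq_abs, h] at hx⟩
      · exact ⟨-x, by simpa using hx1.le, by rwa [Real.norm_eq_abs, h, ← map_neg] at hx⟩
    have hopen : IsOpen {z : Metric.closedBall (0 : E) 1 | κ * ‖L‖ < L z} :=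
      isOpen_lt continuous_const (by fun_prop)
    obtain ⟨k, hk⟩ := (TopologicalSpace.denseRange_denseSeq
      (Metric.closedBall (0 : E) 1)).exists_mem_open hopen ⟨⟨y, by simpa using hy1⟩, hy⟩
    exact ⟨k, le_of_lt hk⟩
  refine ⟨fun L => e (Nat.find (hex L)), ?_, fun L => ⟨he _, Nat.find_spec (hex L)⟩⟩
  refine (measurable_from_nat (f := e)).comp (measurable_find hex fun k => ?_)
  exact (isClosed_le (by fun_prop) (by fun_prop)).measurableSet

variable [MeasurableSpace E] [BorelSpace E]

set_option maxHeartbeats 1000000 in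
/-- Duality between `L^p` and `L^q`, with a bounded almost maximizing vector field. -/
lemma exists_direction_of_bounded {p q : ℝ} (hpq : p.HolderConjugate q) {P : Measure E}
    [IsProbabilityMeasure P] {G : E → E →L[ℝ] ℝ} (hG : Measurable G) {B : ℝ}
    (hB : ∀ x, ‖G x‖ ≤ B) {s : ℝ} (hs : 0 ≤ s)
    (hsG : ENNReal.ofReal s ^ q < ∫⁻ x, ‖G x‖ₑ ^ q ∂P) :
    ∃ v : E → E, Measurable v ∧ (∃ M, ∀ x, ‖v x‖ ≤ M) ∧ (∀ x, G x = 0 → v x = 0) ∧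
      ∫⁻ x, ‖v x‖ₑ ^ p ∂P ≤ 1 ∧ s ≤ ∫ x, G x (v x) ∂P := by
  have : ProperSpace E := FiniteDimensional.proper_real E
  have hp0 := hpq.pos
  have hq0 := hpq.symm.pos
  have hq1 : 0 < q - 1 := hpq.symm.sub_one_pos
  have hB0 : 0 ≤ B := (norm_nonneg _).trans (hB 0)
  have hint : Integrable (fun x => ‖G x‖ ^ q) P := by
    refine Integrable.of_bound (hG.norm.pow_const q).aestronglyMeasurable (B ^ q) (Eventually.of_forall fun x => ?_)
    rw [Real.norm_of_nonneg (by positivity)]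
    exact Real.rpow_le_rpow (norm_nonneg _) (hB x) hq0.le
  set I : ℝ := ∫ x, ‖G x‖ ^ q ∂P with hI
  have hIl : ∫⁻ x, ‖G x‖ₑ ^ q ∂P = ENNReal.ofReal I := by
    rw [hI, ofReal_integral_eq_lintegral_ofReal hint
      (Eventually.of_forall fun x => by positivity)]
    refine lintegral_congr fun x => ?_
    rw [← ofReal_norm, ENNReal.ofReal_rpow_of_nonneg (norm_nonneg _) hq0.le]
  rw [hIl, ENNReal.ofReal_rpow_of_nonneg hs hq0.le,
    ENNReal.ofReal_lt_ofReal_iff_of_nonneg (by positivity)] at hsG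
  have hI0 : 0 < I := (Real.rpow_nonneg hs q).trans_lt hsG
  have hsI : s < I ^ (1 / q) := by
    have := Real.rpow_lt_rpow (by positivity) hsG (one_div_pos.2 hq0)
    rwa [← Real.rpow_mul hs, mul_one_div_cancel hq0.ne', Real.rpow_one] at this
  have hIq : 0 < I ^ (1 / q) := by positivity
  -- This `κ` gives up exactly the surplus of `‖G‖_q = I ^ (1 / q)` over `s`.
  obtain ⟨Φ, hΦ, hΦL⟩ := exists_measurable_almost_norming (E := E) (κ := s / I ^ (1 / q))
    ((div_lt_one hIq).2 hsI)
  -- Equality case of Hölder: `v` has size proportional to `‖G‖ ^ (q - 1)`. As `(q - 1) * p = q`,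
  -- this `c` normalizes the `L^p` norm, and `c * I = I ^ (1 / q)`.
  set c : ℝ := I ^ (-(1 / p)) with hc
  have hc0 : 0 < c := by positivity
  obtain ⟨w, hwdef⟩ : ∃ w : E → E, ∀ x, w x = (c * ‖G x‖ ^ (q - 1)) • Φ (G x) := ⟨_, fun _ => rfl⟩
  have hm : Measurable w := by
    rw [funext hwdef]
    exact ((hG.norm.pow_const (q - 1)).const_mul c).smul (hΦ.comp hG)
  have hv : ∀ x, ‖w x‖ ≤ c * ‖G x‖ ^ (q - 1) := fun x => by
    rw [hwdef, norm_smul, Real.norm_of_nonneg (by positivity)]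
    exact mul_le_of_le_one_right (by positivity) (hΦL _).1
  have hvB : ∀ x, ‖w x‖ ≤ c * B ^ (q - 1) := fun x =>
    (hv x).trans (mul_le_mul_of_nonneg_left
      (Real.rpow_le_rpow (norm_nonneg _) (hB x) hq1.le) hc0.le)
  refine ⟨w, hm, ⟨c * B ^ (q - 1), hvB⟩, fun x hx => ?_, ?_, ?_⟩
  · simp [hwdef, hx, Real.zero_rpow hq1.ne']
  · calc ∫⁻ x, ‖w x‖ₑ ^ p ∂P
        ≤ ∫⁻ x, ENNReal.ofReal (c ^ p * ‖G x‖ ^ q) ∂P := by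
          refine lintegral_mono fun x => ?_
          rw [← ofReal_norm, ENNReal.ofReal_rpow_of_nonneg (norm_nonneg _) hp0.le]
          refine ENNReal.ofReal_le_ofReal
            ((Real.rpow_le_rpow (norm_nonneg _) (hv x) hp0.le).trans (le_of_eq ?_))
          rw [Real.mul_rpow hc0.le (by positivity), ← Real.rpow_mul (norm_nonneg _),
            hpq.symm.sub_one_mul_conj]
      _ = ENNReal.ofReal (c ^ p * I) := by
          rw [← ofReal_integral_eq_lintegral_ofReal (hint.const_mul _)
            (Eventually.of_forall fun x => by positivity), integral_const_mul]
      _ = 1 := by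
          rw [hc, ← Real.rpow_mul hI0.le, neg_mul, one_div_mul_cancel hp0.ne',
            Real.rpow_neg_one, inv_mul_cancel₀ hI0.ne', ENNReal.ofReal_one]
  · have hlow : ∀ x, c * (s / I ^ (1 / q)) * ‖G x‖ ^ q ≤ G x (w x) := by
      intro x
      have hpw : ‖G x‖ ^ q = ‖G x‖ ^ (q - 1) * ‖G x‖ := by
        rw [← Real.rpow_add_one' (norm_nonneg _) (by simpa using hq0.ne'), sub_add_cancel]
      rw [hwdef, map_smul, smul_eq_mul, hpw]
      calc _ = c * ‖G x‖ ^ (q - 1) * (s / I ^ (1 / q) * ‖G x‖) := by ring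
        _ ≤ _ := mul_le_mul_of_nonneg_left (hΦL _).2 (by positivity)
    have hev : Measurable fun z : (E →L[ℝ] ℝ) × E => z.1 z.2 :=
      isBoundedBilinearMap_apply.continuous.measurable
    have hGw : Measurable fun x => G x (w x) := hev.comp (hG.prodMk hm)
    have hGv : Integrable (fun x => G x (w x)) P :=
      Integrable.of_bound hGw.aestronglyMeasurable
        (B * (c * B ^ (q - 1))) (Eventually.of_forall fun x =>
          ((G x).le_opNorm _).trans (mul_le_mul (hB x) (hvB x) (norm_nonneg _) hB0))
    have h := integral_mono (hint.const_mul _) hGv hlow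
    rw [integral_const_mul] at h
    refine le_trans (le_of_eq ?_) h
    have hcI : c * I = I ^ (1 / q) := by
      rw [hc, ← Real.rpow_add_one hI0.ne']
      congr 1
      have := hpq.inv_add_inv_eq_one
      simp only [one_div]
      linarith
    rw [← hI, mul_right_comm, hcI, mul_div_cancel₀ _ hIq.ne']

variable {F : Type*} [NormedAddCommGroup F] {Θ : Set F} {Ξ : Set E} {p q : ℝ} {P₀ : Measure E}
  {ℓ : F → E → ℝ}

/-- The finite measure with density `‖G‖ ^ q` is inner regular, so a compact `K` in the interior
already carries more than `s ^ q`. On `K` the field `G` is bounded, which reduces to the bounded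
case. -/
lemma exists_direction (hpq : p.HolderConjugate q)
    (hP₀ : P₀ ∈ ProbOn Ξ) (hfr : P₀ (interior Ξ)ᶜ = 0) {G : E → E →L[ℝ] ℝ}
    (hG : ContinuousOn G Ξ) (hfin : ∫⁻ x, ‖G x‖ₑ ^ q ∂P₀ ≠ ∞) {s : ℝ} (hs : 0 ≤ s)
    (hsG : ENNReal.ofReal s ^ q < ∫⁻ x, ‖G x‖ₑ ^ q ∂P₀) :
    ∃ K ⊆ interior Ξ, IsCompact K ∧ ∃ v : E → E, Measurable v ∧ (∃ M, ∀ x, ‖v x‖ ≤ M) ∧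
      (∀ x ∉ K, v x = 0) ∧ ∫⁻ x, ‖v x‖ₑ ^ p ∂P₀ ≤ 1 ∧ s ≤ ∫ x, G x (v x) ∂P₀ := by
  classical
  have : ProperSpace E := FiniteDimensional.proper_real E
  have := hP₀.1
  have hq0 := hpq.symm.pos
  have hfinm : IsFiniteMeasure (P₀.withDensity fun x => ‖G x‖ₑ ^ q) :=
    isFiniteMeasure_withDensity hfin
  have hU : ENNReal.ofReal s ^ q < P₀.withDensity (fun x => ‖G x‖ₑ ^ q) (interior Ξ) := by
    rw [withDensity_apply _ isOpen_interior.measurableSet,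
      Measure.restrict_eq_self_of_ae_mem (s := interior Ξ) (mem_ae_iff.2 hfr)]
    exact hsG
  obtain ⟨K, hKi, hK, hKs⟩ := isOpen_interior.exists_lt_isCompact hU
  rw [withDensity_apply _ hK.measurableSet] at hKs
  have hKΞ : K ⊆ Ξ := hKi.trans interior_subset
  obtain ⟨B, hB⟩ := (hK.image_of_continuousOn (hG.mono hKΞ)).isBounded.exists_norm_le
  have hGm : Measurable (K.indicator G) := by
    rw [← Set.piecewise_eq_indicator]
    exact (hG.mono hKΞ).measurable_piecewise continuousOn_const hK.measurableSet
  have hB' : ∀ x, ‖K.indicator G x‖ ≤ max B 0 := fun x => by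
    by_cases hx : x ∈ K
    · rw [Set.indicator_of_mem hx]
      exact (hB _ ⟨x, hx, rfl⟩).trans (le_max_left _ _)
    · rw [Set.indicator_of_notMem hx, norm_zero]
      exact le_max_right _ _
  have hlint : ∫⁻ x in K, ‖G x‖ₑ ^ q ∂P₀ = ∫⁻ x, ‖K.indicator G x‖ₑ ^ q ∂P₀ := by
    rw [← lintegral_indicator hK.measurableSet]
    refine lintegral_congr fun x => ?_
    by_cases hx : x ∈ K
    · rw [Set.indicator_of_mem hx, Set.indicator_of_mem hx]
    · have h0 : ‖K.indicator G x‖ₑ = 0 := by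
        rw [Set.indicator_of_notMem hx, ← ofReal_norm, norm_zero, ENNReal.ofReal_zero]
      rw [h0, Set.indicator_of_notMem hx, ENNReal.zero_rpow_of_pos hq0]
  rw [hlint] at hKs
  obtain ⟨v, hv, hM, hv0, hvp, hvs⟩ := exists_direction_of_bounded hpq hGm hB' hs hKs
  refine ⟨K, hKi, hK, v, hv, hM, fun x hx => hv0 x (Set.indicator_of_notMem hx _), hvp,
    hvs.trans (le_of_eq (integral_congr_ae (Eventually.of_forall fun x => ?_)))⟩
  by_cases hx : x ∈ K
  · simp [hx]
  · simp [hx, hv0 x (Set.indicator_of_notMem hx _)]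

omit [NormedSpace ℝ E] [FiniteDimensional ℝ E] [BorelSpace E] in
lemma measure_compl_interior_eq_zero {P : Measure E} (hP : P ∈ ProbOn Ξ) (hfr : P (frontier Ξ) = 0) : P (interior Ξ)ᶜ = 0 := by
  refine measure_mono_null (fun x hx => ?_) (measure_union_null hP.2 hfr)
  by_cases h : x ∈ Ξ
  · exact Or.inr ⟨subset_closure h, hx⟩
  · exact Or.inl h

/-- To first order, the worst-case expected excess loss grows at least at the rate `gradDist`,
locally uniformly in the parameters. -/
lemma exists_integral_ge_of_lt_gradDist (hpq : p.HolderConjugate q) (hΞc : IsClosed Ξ)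
    (hΞ : Convex ℝ Ξ) (hP₀ : P₀ ∈ ProbOn Ξ)
    (hm : MemLp (fun x => x) (ENNReal.ofReal p) P₀) (hfr : P₀ (frontier Ξ) = 0)
    (h₁ : SmoothLoss Θ Ξ p ℓ) {θ β : F} (hθ : θ ∈ Θ) (hβ : β ∈ Θ) {s : ℝ} (hs0 : 0 ≤ s)
    (hs : ENNReal.ofReal s < gradDist Ξ q P₀ ℓ θ β) :
    ∃ r > 0, ∀ θ' ∈ Θ, dist θ' θ < r → ∀ β' ∈ Θ, dist β' β < r → ∀ δ, 0 < δ → δ < r →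
      ∃ P ∈ ball Ξ p P₀ δ,
        ∫ x, (ℓ θ' x - ℓ β' x) ∂P₀ + s * δ ≤ ∫ x, (ℓ θ' x - ℓ β' x) ∂P := by
  have : ProperSpace E := FiniteDimensional.proper_real E
  have := hP₀.1
  have hp := hpq.lt
  have hp0 := hpq.pos
  have hq0 := hpq.symm.pos
  obtain ⟨s₁, hs₁0, hss₁, hs₁⟩ : ∃ s₁ : ℝ, 0 ≤ s₁ ∧ s < s₁ ∧
      ENNReal.ofReal s₁ < gradDist Ξ q P₀ ℓ θ β := by
    obtain ⟨s₁, h0, h1, h2⟩ := ENNReal.lt_iff_exists_real_btwn.1 hs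
    exact ⟨s₁, h0, (ENNReal.ofReal_lt_ofReal_iff_of_nonneg hs0).1 h1, h2⟩
  have hpow : (gradDist Ξ q P₀ ℓ θ β) ^ q =
      ∫⁻ x, ‖grad Ξ ℓ θ x - grad Ξ ℓ β x‖ₑ ^ q ∂P₀ := by
    rw [gradDist, ← ENNReal.rpow_mul, one_div_mul_cancel hq0.ne', ENNReal.rpow_one]
  have hsG := ENNReal.rpow_lt_rpow hs₁ hq0
  rw [hpow] at hsG
  have hfin : ∫⁻ x, ‖grad Ξ ℓ θ x - grad Ξ ℓ β x‖ₑ ^ q ∂P₀ ≠ ∞ := by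
    rw [← hpow]
    exact (ENNReal.rpow_lt_top_of_nonneg hq0.le
      (gradDist_lt_top hpq hΞc hP₀ hm h₁ hθ hβ).ne).ne
  obtain ⟨K, hKi, hK, v, hv, ⟨M', hM'⟩, hvK, hvp, hvs⟩ := exists_direction hpq hP₀
    (measure_compl_interior_eq_zero hP₀ hfr) (h₁.continuousOn_grad_sub hθ hβ) hfin hs₁0 hsG
  obtain ⟨M, hM0, hM⟩ : ∃ M : ℝ, 0 < M ∧ ∀ x, ‖v x‖ ≤ M :=
    ⟨max M' 1, lt_max_of_lt_right one_pos, fun x => (hM' x).trans (le_max_left _ _)⟩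
  have hKΞ : K ⊆ Ξ := hKi.trans interior_subset
  -- Points of `K` move by at most `δ * M < η`, hence stay in `Ξ`; points off `K` do not move.
  obtain ⟨η, hη, hηK⟩ := hK.exists_cthickening_subset_open isOpen_interior hKi
  obtain ⟨r₁, hr₁, hunif⟩ := exists_norm_grad_sub_sub_le h₁.2.1 hK hKΞ hθ hβ
    -- The gradient error is multiplied by a displacement of at most `δ * M`, so its total cost is
    -- at most `(s₁ - s) * δ`.
    (ε := (s₁ - s) / M) (div_pos (by linarith) hM0)
  refine ⟨min r₁ (min (r₁ / M) (η / M)), by positivity,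
    fun θ' hθ' hdθ β' hβ' hdβ δ hδ hδr => ?_⟩
  have hδ₁ : δ * M < r₁ := (lt_div_iff₀ hM0).1
    (hδr.trans_le ((min_le_right _ _).trans (min_le_left _ _)))
  have hδ₂ : δ * M < η := (lt_div_iff₀ hM0).1
    (hδr.trans_le ((min_le_right _ _).trans (min_le_right _ _)))
  have hδv : ∀ x, ‖δ • v x‖ ≤ δ * M := fun x => by
    rw [norm_smul, Real.norm_of_nonneg hδ.le]
    exact mul_le_mul_of_nonneg_left (hM x) hδ.le
  have hT : Measurable fun x => x + δ • v x := by fun_prop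
  have hTΞ : ∀ x ∈ Ξ, x + δ • v x ∈ Ξ := by
    intro x hx
    by_cases hxK : x ∈ K
    · refine interior_subset (hηK (Metric.mem_cthickening_of_dist_le _ x η K hxK ?_))
      rw [dist_eq_norm, add_sub_cancel_left]
      exact (hδv x).trans hδ₂.le
    · simpa [hvK x hxK] using hx
  set P : Measure E := P₀.map fun x => x + δ • v x with hP
  have hPon : P ∈ ProbOn Ξ := by
    refine ⟨Measure.isProbabilityMeasure_map hT.aemeasurable, ?_⟩
    rw [hP, Measure.map_apply hT hΞc.measurableSet.compl]
    exact measure_mono_null (fun x hx hx' => hx (hTΞ x hx')) hP₀.2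
  have hπ : P₀.map (fun x => (x, x + δ • v x)) ∈ couplings P₀ P := by
    constructor
    · rw [Measure.map_map measurable_fst (by fun_prop)]
      exact Measure.map_id
    · rw [Measure.map_map measurable_snd (by fun_prop)]
      rfl
  have hcost : ∫⁻ z, ‖z.1 - z.2‖ₑ ^ p ∂(P₀.map fun x => (x, x + δ • v x)) ≤
      ENNReal.ofReal δ ^ p := by
    rw [lintegral_map (by fun_prop) (by fun_prop)]
    calc ∫⁻ x, ‖x - (x + δ • v x)‖ₑ ^ p ∂P₀ = ∫⁻ x, ENNReal.ofReal δ ^ p * ‖v x‖ₑ ^ p ∂P₀ := by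
          refine lintegral_congr fun x => ?_
          rw [sub_add_cancel_left, enorm_neg, enorm_smul, Real.enorm_eq_ofReal hδ.le,
            ENNReal.mul_rpow_of_nonneg _ _ hp0.le]
      _ = ENNReal.ofReal δ ^ p * ∫⁻ x, ‖v x‖ₑ ^ p ∂P₀ := lintegral_const_mul _ (by fun_prop)
      _ ≤ ENNReal.ofReal δ ^ p * 1 := by gcongr
      _ = _ := mul_one _
  have hPball : P ∈ ball Ξ p P₀ δ := by
    refine ⟨hPon, ?_⟩
    rw [wasserstein]
    calc _ ≤ (ENNReal.ofReal δ ^ p) ^ (1 / p) :=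
          ENNReal.rpow_le_rpow ((iInf₂_le _ hπ).trans hcost) (one_div_pos.2 hp0).le
      _ = _ := by rw [← ENNReal.rpow_mul, mul_one_div_cancel hp0.ne', ENNReal.rpow_one]
  refine ⟨P, hPball, ?_⟩
  have hmP := memLp_snd_of_coupling hp hπ hm
    (hcost.trans_lt (ENNReal.rpow_lt_top_of_nonneg hp0.le ENNReal.ofReal_ne_top))
  have i₀ : Integrable (fun x => ℓ θ' x - ℓ β' x) P₀ :=
    (integrable_loss hp hΞc hΞ h₁ hP₀ hm hθ').sub (integrable_loss hp hΞc hΞ h₁ hP₀ hm hβ')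
  have i₁ : Integrable (fun x => ℓ θ' x - ℓ β' x) P :=
    (integrable_loss hp hΞc hΞ h₁ hPon hmP hθ').sub (integrable_loss hp hΞc hΞ h₁ hPon hmP hβ')
  have e₁ : ∫ x, (ℓ θ' x - ℓ β' x) ∂P =
      ∫ x, (ℓ θ' (x + δ • v x) - ℓ β' (x + δ • v x)) ∂P₀ :=
    integral_map hT.aemeasurable i₁.aestronglyMeasurable
  have i₂ : Integrable (fun x => ℓ θ' (x + δ • v x) - ℓ β' (x + δ • v x)) P₀ :=
    i₁.comp_measurable hT
  have hpt : ∀ x ∈ Ξ, δ * (grad Ξ ℓ θ x - grad Ξ ℓ β x) (v x) - (s₁ - s) * δ ≤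
      (ℓ θ' (x + δ • v x) - ℓ β' (x + δ • v x)) - (ℓ θ' x - ℓ β' x) := by
    intro x hx
    by_cases hxK : x ∈ K
    · have hseg := abs_loss_sub_le_of_segment h₁.1 hΞ hθ' hβ' hx (hTΞ x hx)
        (φ := grad Ξ ℓ θ x - grad Ξ ℓ β x) (C := (s₁ - s) / M) fun z hz =>
          hunif θ' hθ' (hdθ.trans_le (min_le_left _ _)) β' hβ' (hdβ.trans_le (min_le_left _ _))
            x hxK z (hΞ.segment_subset hx (hTΞ x hx) hz) (by
              have h1 := norm_sub_le_of_mem_segment hz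
              rw [add_sub_cancel_left] at h1
              rw [dist_eq_norm]
              exact (h1.trans (hδv x)).trans_lt hδ₁)
      rw [add_sub_cancel_left, map_smul, smul_eq_mul] at hseg
      have hb : (s₁ - s) / M * ‖δ • v x‖ ≤ (s₁ - s) * δ := by
        rw [div_mul_eq_mul_div, div_le_iff₀ hM0, mul_assoc]
        exact mul_le_mul_of_nonneg_left (hδv x) (by linarith)
      have := (abs_le.1 (hseg.trans hb)).1
      linarith
    · simp only [hvK x hxK, smul_zero, add_zero, map_zero, mul_zero, sub_self, zero_sub]
      have : 0 ≤ (s₁ - s) * δ := mul_nonneg (by linarith) hδ.le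
      linarith
  by_cases hGv : Integrable (fun x => (grad Ξ ℓ θ x - grad Ξ ℓ β x) (v x)) P₀
  · have hmono := integral_mono_ae ((hGv.const_mul δ).sub (integrable_const ((s₁ - s) * δ)))
      (i₂.sub i₀) ((ae_mem_of_mem_probOn hP₀).mono hpt)
    simp only [Pi.sub_apply] at hmono
    rw [integral_sub (hGv.const_mul δ) (integrable_const _), integral_const_mul,
      integral_sub i₂ i₀, ← e₁] at hmono
    simp only [integral_const, probReal_univ, smul_eq_mul, one_mul] at hmono
    have := mul_le_mul_of_nonneg_left hvs hδ.le
    linarith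
  -- The default value `0` of the integral would give `s₁ ≤ 0`, against `0 ≤ s < s₁`.
  · rw [integral_undef hGv] at hvs
    linarith

end WDRRO

namespace WDRRO

/-! ### Monotonicity in the radius and the first-order expansion -/

section Balls

variable {E F : Type*} [NormedAddCommGroup E] [MeasurableSpace E] {Ξ : Set E} {p : ℝ}
  {P₀ : Measure E} {ℓ : F → E → ℝ}

lemma ball_mono {δ δ' : ℝ} (h : δ ≤ δ') : ball Ξ p P₀ δ ⊆ ball Ξ p P₀ δ' :=
  fun _ hP => ⟨hP.1, hP.2.trans (ENNReal.ofReal_le_ofReal h)⟩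

lemma mem_ball_self [BorelSpace E] [SecondCountableTopology E] (hp : 0 < p)
    (hP₀ : P₀ ∈ ProbOn Ξ) (δ : ℝ) : P₀ ∈ ball Ξ p P₀ δ := by
  refine ⟨hP₀, ?_⟩
  have hπ : P₀.map (fun x => (x, x)) ∈ couplings P₀ P₀ := by
    constructor
    · rw [Measure.map_map measurable_fst (by fun_prop)]
      exact Measure.map_id
    · rw [Measure.map_map measurable_snd (by fun_prop)]
      exact Measure.map_id
  have h0 : (⨅ π ∈ couplings P₀ P₀, ∫⁻ z, ‖z.1 - z.2‖ₑ ^ p ∂π) = 0 := by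
    refine le_antisymm ((iInf₂_le _ hπ).trans (le_of_eq ?_)) zero_le
    rw [lintegral_map (by fun_prop) (by fun_prop)]
    simp [hp]
  rw [wasserstein, h0, ENNReal.zero_rpow_of_pos (one_div_pos.2 hp)]
  exact zero_le

lemma excess_mono {δ δ' : ℝ} (h : δ ≤ δ') (θ β : F) :
    excess Ξ p P₀ ℓ δ θ β ≤ excess Ξ p P₀ ℓ δ' θ β :=
  biSup_mono fun _ hP => ball_mono h hP

lemma regret_mono {Θ : Set F} {δ δ' : ℝ} (h : δ ≤ δ') (θ : F) :
    regret Θ Ξ p P₀ ℓ δ θ ≤ regret Θ Ξ p P₀ ℓ δ' θ :=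
  iSup₂_mono fun _ _ => excess_mono h _ _

end Balls

/-- First-order expansion of the worst-case excess loss in the radius, with slope `gradDist`,
locally uniform in the parameters. -/
structure FirstOrderExpansion {E F : Type*} [NormedAddCommGroup E] [NormedSpace ℝ E]
    [MeasurableSpace E] [NormedAddCommGroup F] (Θ : Set F) (Ξ : Set E) (p q : ℝ)
    (P₀ : Measure E) (ℓ : F → E → ℝ) : Prop where
  excess_zero : ∀ θ ∈ Θ, ∀ β ∈ Θ,
    excess Ξ p P₀ ℓ 0 θ β = ((∫ x, ℓ θ x ∂P₀ - ∫ x, ℓ β x ∂P₀ : ℝ) : EReal)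
  le : ∀ θ ∈ Θ, ∀ β ∈ Θ, ∀ s : ℝ, gradDist Ξ q P₀ ℓ θ β < ENNReal.ofReal s →
    ∃ r > 0, ∀ θ' ∈ Θ, dist θ' θ < r → ∀ β' ∈ Θ, dist β' β < r → ∀ δ, 0 < δ → δ < r →
      excess Ξ p P₀ ℓ δ θ' β' ≤ ((∫ x, ℓ θ' x ∂P₀ - ∫ x, ℓ β' x ∂P₀ + s * δ : ℝ) : EReal)
  ge : ∀ θ ∈ Θ, ∀ β ∈ Θ, ∀ s : ℝ, s < 0 ∨ ENNReal.ofReal s < gradDist Ξ q P₀ ℓ θ β →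
    ∃ r > 0, ∀ θ' ∈ Θ, dist θ' θ < r → ∀ β' ∈ Θ, dist β' β < r → ∀ δ, 0 < δ → δ < r →
      ((∫ x, ℓ θ' x ∂P₀ - ∫ x, ℓ β' x ∂P₀ + s * δ : ℝ) : EReal) ≤ excess Ξ p P₀ ℓ δ θ' β'
  gradDist_lt_top : ∀ θ ∈ Θ, ∀ β ∈ Θ, gradDist Ξ q P₀ ℓ θ β < ⊤

lemma firstOrderExpansion {E F : Type*} [NormedAddCommGroup E] [NormedSpace ℝ E]
    [FiniteDimensional ℝ E] [MeasurableSpace E] [BorelSpace E] [NormedAddCommGroup F]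
    {Θ : Set F} {Ξ : Set E} {p q : ℝ} {P₀ : Measure E} {ℓ : F → E → ℝ}
    (hpq : p.HolderConjugate q) (hΞc : IsClosed Ξ)
    (hΞ : Convex ℝ Ξ) (hP₀ : P₀ ∈ ProbOn Ξ)
    (hm : MemLp (fun x => x) (ENNReal.ofReal p) P₀) (hfr : P₀ (frontier Ξ) = 0)
    (h₁ : SmoothLoss Θ Ξ p ℓ) : FirstOrderExpansion Θ Ξ p q P₀ ℓ := by
  have : ProperSpace E := FiniteDimensional.proper_real E
  have hsub : ∀ θ ∈ Θ, ∀ β ∈ Θ,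
      ∫ x, (ℓ θ x - ℓ β x) ∂P₀ = ∫ x, ℓ θ x ∂P₀ - ∫ x, ℓ β x ∂P₀ := fun θ hθ β hβ =>
    integral_sub (integrable_loss hpq.lt hΞc hΞ h₁ hP₀ hm hθ)
      (integrable_loss hpq.lt hΞc hΞ h₁ hP₀ hm hβ)
  have hself : ∀ δ, ∀ θ ∈ Θ, ∀ β ∈ Θ, ((∫ x, ℓ θ x ∂P₀ - ∫ x, ℓ β x ∂P₀ : ℝ) : EReal) ≤
      excess Ξ p P₀ ℓ δ θ β := fun δ θ hθ β hβ => by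
    rw [← hsub θ hθ β hβ]
    exact le_iSup₂ (f := fun P (_ : P ∈ ball Ξ p P₀ δ) =>
      ((∫ x, (ℓ θ x - ℓ β x) ∂P : ℝ) : EReal)) P₀ (mem_ball_self hpq.pos hP₀ δ)
  refine ⟨fun θ hθ β hβ => le_antisymm ?_ (hself 0 θ hθ β hβ), fun θ hθ β hβ s hs => ?_,
    fun θ hθ β hβ s hs => ?_, fun θ hθ β hβ => gradDist_lt_top hpq hΞc hP₀ hm h₁ hθ hβ⟩
  -- The ball of radius `0` lies in every ball, so the upper bound with `δ → 0` suffices; zero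
  -- distance need not be shown to force equality with `P₀`.
  · have hlt := gradDist_lt_top hpq hΞc hP₀ hm h₁ hθ hβ
    obtain ⟨s, -, hs, -⟩ := ENNReal.lt_iff_exists_real_btwn.1 hlt
    obtain ⟨r, hr, h⟩ := exists_integral_le_of_gradDist_lt hpq hΞc hΞ hP₀ hm h₁ hθ hβ hs
    refine iSup₂_le fun P hP => EReal.coe_le_coe_iff.2 ?_
    have hlim : Tendsto (fun δ : ℝ => ∫ x, (ℓ θ x - ℓ β x) ∂P₀ + s * δ) (𝓝[>] 0)
        (𝓝 (∫ x, (ℓ θ x - ℓ β x) ∂P₀ + s * 0)) := by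
      refine Tendsto.mono_left (Continuous.tendsto ?_ _) nhdsWithin_le_nhds
      fun_prop
    rw [mul_zero, add_zero, hsub θ hθ β hβ] at hlim
    refine ge_of_tendsto hlim ?_
    filter_upwards [Ioo_mem_nhdsGT hr] with δ hδ
    rw [← hsub θ hθ β hβ]
    exact h θ hθ (by simpa using hr) β hβ (by simpa using hr) δ hδ.1 hδ.2 P
      (ball_mono hδ.1.le hP)
  · obtain ⟨r, hr, h⟩ := exists_integral_le_of_gradDist_lt hpq hΞc hΞ hP₀ hm h₁ hθ hβ hs
    refine ⟨r, hr, fun θ' hθ' hd β' hβ' hd' δ hδ hδr => iSup₂_le fun P hP => ?_⟩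
    rw [← hsub θ' hθ' β' hβ']
    exact EReal.coe_le_coe_iff.2 (h θ' hθ' hd β' hβ' hd' δ hδ hδr P hP)
  -- Negative slopes are treated apart because `ENNReal.ofReal` truncates them to `0`, which is not
  -- below a vanishing `gradDist`. For them `P₀` itself is a good enough competitor.
  · rcases lt_or_ge s 0 with hs0 | hs0
    · refine ⟨1, one_pos, fun θ' hθ' hd β' hβ' hd' δ hδ hδr => le_trans ?_ (hself δ θ' hθ' β' hβ')⟩
      have := mul_neg_of_neg_of_pos hs0 hδ
      exact EReal.coe_le_coe_iff.2 (by linarith)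
    · obtain ⟨r, hr, h⟩ := exists_integral_ge_of_lt_gradDist hpq hΞc hΞ hP₀ hm hfr h₁ hθ hβ hs0
        (hs.resolve_left hs0.not_gt)
      refine ⟨r, hr, fun θ' hθ' hd β' hβ' hd' δ hδ hδr => ?_⟩
      obtain ⟨P, hP, hPs⟩ := h θ' hθ' hd β' hβ' hd' δ hδ hδr
      rw [← hsub θ' hθ' β' hβ']
      exact (EReal.coe_le_coe_iff.2 hPs).trans (le_iSup₂ (f := fun P (_ : P ∈ ball Ξ p P₀ δ) =>
        ((∫ x, (ℓ θ' x - ℓ β' x) ∂P : ℝ) : EReal)) P hP)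

lemma exists_seq_of_frequently_nhdsGT {Q : ℝ → Prop} (h : ∃ᶠ δ in 𝓝[>] (0 : ℝ), Q δ) :
    ∃ δ : ℕ → ℝ, (∀ n, 0 < δ n) ∧ Tendsto δ atTop (𝓝 0) ∧ ∀ n, Q (δ n) := by
  obtain ⟨δ, hδ, hQ⟩ := exists_seq_forall_of_frequently
    (h.and_eventually (self_mem_nhdsWithin (s := Set.Ioi (0 : ℝ))))
  exact ⟨δ, fun n => (hQ n).2, hδ.mono_right nhdsWithin_le_nhds, fun n => (hQ n).1⟩

/-! ### From the expansion to derivatives of the regret -/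

section Regret

variable {E F : Type*} [NormedAddCommGroup E] [NormedSpace ℝ E]
  [MeasurableSpace E] [NormedAddCommGroup F] {Θ : Set F} {Ξ : Set E} {p q : ℝ}
  {P₀ : Measure E} {ℓ : F → E → ℝ}

omit [NormedSpace ℝ E] [NormedAddCommGroup F] in
lemma le_regret {δ : ℝ} (θ : F) {β : F} (hβ : β ∈ Θ) :
    excess Ξ p P₀ ℓ δ θ β ≤ regret Θ Ξ p P₀ ℓ δ θ :=
  le_iSup₂ (f := fun β (_ : β ∈ Θ) => excess Ξ p P₀ ℓ δ θ β) β hβ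

omit [NormedSpace ℝ E] in
lemma minimizers_zero_nonempty (h₂ : MinimizersConverge Θ Ξ p P₀ ℓ) :
    (minimizers Θ Ξ p P₀ ℓ 0).Nonempty := by
  obtain ⟨δ, hδ, hδ0, h⟩ := exists_seq_of_frequently_nhdsGT h₂.1.frequently
  choose t ht using h
  obtain ⟨-, -, θ, hθ, -⟩ := h₂.2 δ t hδ hδ0 ht
  exact ⟨θ, hθ⟩

/-- `Q` is meant to be the failure of a desired bound, so that the subsequence is extracted among
bad radii. The limit `β` depends on `Q` but serves all `s` at once. -/
lemma FirstOrderExpansion.frequently_regret_le (hexp : FirstOrderExpansion Θ Ξ p q P₀ ℓ)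
    (h₃ : MaximizersConverge Θ Ξ p P₀ ℓ) {θ : F} (hθ : θ ∈ minimizers Θ Ξ p P₀ ℓ 0)
    {Q : ℝ → Prop} (hQ : ∃ᶠ δ in 𝓝[>] (0 : ℝ), Q δ) :
    ∃ β ∈ minimizers Θ Ξ p P₀ ℓ 0, ∀ s : ℝ, gradDist Ξ q P₀ ℓ θ β < ENNReal.ofReal s →
      ∃ᶠ δ in 𝓝[>] (0 : ℝ), 0 < δ ∧ Q δ ∧ ∃ β' ∈ Θ, regret Θ Ξ p P₀ ℓ δ θ ≤
        ((∫ x, ℓ θ x ∂P₀ - ∫ x, ℓ β' x ∂P₀ + s * δ : ℝ) : EReal) := by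
  obtain ⟨b, hb, hsub⟩ := h₃ θ hθ
  obtain ⟨δ, hδ, hδ0, h⟩ := exists_seq_of_frequently_nhdsGT (hQ.and_eventually hb)
  obtain ⟨φ, hφ, β, hβ, hlim⟩ := hsub δ hδ hδ0
  refine ⟨β, hβ, fun s hs => ?_⟩
  obtain ⟨r, hr, hle⟩ := hexp.le θ hθ.1 β hβ.1 s hs
  have hlim0 : Tendsto (fun n => δ (φ n)) atTop (𝓝[>] 0) :=
    tendsto_nhdsWithin_iff.2 ⟨hδ0.comp hφ.tendsto_atTop, Eventually.of_forall fun n => hδ _⟩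
  refine hlim0.frequently (Eventually.frequently ?_)
  filter_upwards [hlim.eventually (Metric.ball_mem_nhds _ hr),
    hlim0.eventually (Ioo_mem_nhdsGT hr)] with n hn1 hn2
  obtain ⟨hQn, hbn, hbeq⟩ := h (φ n)
  refine ⟨hδ _, hQn, b (δ (φ n)), hbn, ?_⟩
  rw [← hbeq]
  exact hle θ hθ.1 (by simpa using hr) _ hbn hn1 _ (hδ _) hn2.2

lemma FirstOrderExpansion.exists_le_optRegret (hexp : FirstOrderExpansion Θ Ξ p q P₀ ℓ)
    (h₂ : MinimizersConverge Θ Ξ p P₀ ℓ)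
    {Q : ℝ → Prop} (hQ : ∃ᶠ δ in 𝓝[>] (0 : ℝ), Q δ) :
    ∃ θ ∈ minimizers Θ Ξ p P₀ ℓ 0, ∀ β ∈ minimizers Θ Ξ p P₀ ℓ 0, ∀ s : ℝ,
      s < 0 ∨ ENNReal.ofReal s < gradDist Ξ q P₀ ℓ θ β →
      ∃ δ > 0, Q δ ∧ ∃ θ' ∈ Θ, ((∫ x, ℓ θ' x ∂P₀ - ∫ x, ℓ β x ∂P₀ + s * δ : ℝ) : EReal) ≤
        optRegret Θ Ξ p P₀ ℓ δ := by
  obtain ⟨δ, hδ, hδ0, h⟩ := exists_seq_of_frequently_nhdsGT (hQ.and_eventually h₂.1)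
  choose t ht using fun n => (h n).2
  obtain ⟨φ, hφ, θ, hθ, hlim⟩ := h₂.2 δ t hδ hδ0 ht
  refine ⟨θ, hθ, fun β hβ s hs => ?_⟩
  obtain ⟨r, hr, hge⟩ := hexp.ge θ hθ.1 β hβ.1 s hs
  obtain ⟨n, hn1, hn2⟩ := ((hlim.eventually (Metric.ball_mem_nhds _ hr)).and
    ((hδ0.comp hφ.tendsto_atTop).eventually_lt_const hr)).exists
  refine ⟨δ (φ n), hδ _, (h (φ n)).1, t (φ n), (ht _).1, ?_⟩
  refine le_trans ?_ (le_iInf₂ fun θ' hθ' => (ht (φ n)).2 θ' hθ')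
  exact (hge _ (ht _).1 hn1 β hβ.1 (by simpa using hr) _ (hδ _) hn2).trans (le_regret _ hβ.1)

/-- Minimizing the regret at radius `0` means minimizing expected loss only if that regret is
finite: were it `⊤` everywhere, all points would be minimizers. Finiteness comes from the bound at
some positive radius and monotonicity. -/
lemma FirstOrderExpansion.integral_le (hexp : FirstOrderExpansion Θ Ξ p q P₀ ℓ)
    (h₃ : MaximizersConverge Θ Ξ p P₀ ℓ) {θ : F} (hθ : θ ∈ minimizers Θ Ξ p P₀ ℓ 0)
    {β : F} (hβ : β ∈ Θ) : ∫ x, ℓ θ x ∂P₀ ≤ ∫ x, ℓ β x ∂P₀ := by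
  have htop : regret Θ Ξ p P₀ ℓ 0 θ < ⊤ := by
    obtain ⟨β', hβ', h⟩ := hexp.frequently_regret_le h₃ hθ (Q := fun _ => True)
      (Eventually.of_forall fun _ => trivial).frequently
    obtain ⟨s, -, hs, -⟩ :=
      ENNReal.lt_iff_exists_real_btwn.1 (hexp.gradDist_lt_top θ hθ.1 β' hβ'.1)
    obtain ⟨δ, hδ, -, β'', -, hle⟩ := (h s hs).exists
    exact ((regret_mono hδ.le θ).trans hle).trans_lt (EReal.coe_lt_top _)
  have hge : ∀ β' ∈ Θ, ((∫ x, ℓ θ x ∂P₀ - ∫ x, ℓ β' x ∂P₀ : ℝ) : EReal) ≤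
      regret Θ Ξ p P₀ ℓ 0 θ := fun β' hβ' => by
    rw [← hexp.excess_zero θ hθ.1 β' hβ']
    exact le_regret θ hβ'
  have hbot : regret Θ Ξ p P₀ ℓ 0 θ ≠ ⊥ :=
    ((EReal.bot_lt_coe _).trans_le (hge θ hθ.1)).ne'
  obtain ⟨R, hR⟩ : ∃ R : ℝ, (R : EReal) = regret Θ Ξ p P₀ ℓ 0 θ :=
    ⟨_, EReal.coe_toReal htop.ne hbot⟩
  -- Replacing `θ` by `β` shifts every excess by the same constant; a better `β` would thus have
  -- smaller regret.
  have hβR : regret Θ Ξ p P₀ ℓ 0 β ≤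
      ((R - (∫ x, ℓ θ x ∂P₀ - ∫ x, ℓ β x ∂P₀) : ℝ) : EReal) := by
    refine iSup₂_le fun β' hβ' => ?_
    rw [hexp.excess_zero β hβ β' hβ']
    have := hge β' hβ'
    rw [← hR, EReal.coe_le_coe_iff] at this
    exact EReal.coe_le_coe_iff.2 (by linarith)
  have := (hθ.2 β hβ).trans hβR
  rw [← hR, EReal.coe_le_coe_iff] at this
  linarith

lemma FirstOrderExpansion.regret_nonneg (hexp : FirstOrderExpansion Θ Ξ p q P₀ ℓ)
    {θ : F} (hθ : θ ∈ Θ) {δ : ℝ} (hδ : 0 ≤ δ) : 0 ≤ regret Θ Ξ p P₀ ℓ δ θ := by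
  refine le_trans ?_ ((excess_mono hδ θ θ).trans (le_regret θ hθ))
  rw [hexp.excess_zero θ hθ θ hθ, sub_self, EReal.coe_zero]

lemma FirstOrderExpansion.regret_zero (hexp : FirstOrderExpansion Θ Ξ p q P₀ ℓ)
    (h₃ : MaximizersConverge Θ Ξ p P₀ ℓ) {θ : F} (hθ : θ ∈ minimizers Θ Ξ p P₀ ℓ 0) :
    regret Θ Ξ p P₀ ℓ 0 θ = 0 := by
  refine le_antisymm (iSup₂_le fun β hβ => ?_) (hexp.regret_nonneg hθ.1 le_rfl)
  rw [hexp.excess_zero θ hθ.1 β hβ]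
  exact EReal.coe_nonpos.2 (by linarith [hexp.integral_le h₃ hθ hβ])

lemma FirstOrderExpansion.optRegret_nonneg (hexp : FirstOrderExpansion Θ Ξ p q P₀ ℓ)
    {δ : ℝ} (hδ : 0 ≤ δ) : 0 ≤ optRegret Θ Ξ p P₀ ℓ δ :=
  le_iInf₂ fun _ hθ => hexp.regret_nonneg hθ hδ

omit [NormedSpace ℝ E] [NormedAddCommGroup F] in
lemma optRegret_le {δ : ℝ} {θ : F} (hθ : θ ∈ Θ) :
    optRegret Θ Ξ p P₀ ℓ δ ≤ regret Θ Ξ p P₀ ℓ δ θ :=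
  iInf₂_le θ hθ

lemma FirstOrderExpansion.optRegret_zero (hexp : FirstOrderExpansion Θ Ξ p q P₀ ℓ)
    (h₂ : MinimizersConverge Θ Ξ p P₀ ℓ) (h₃ : MaximizersConverge Θ Ξ p P₀ ℓ) :
    optRegret Θ Ξ p P₀ ℓ 0 = 0 := by
  obtain ⟨θ, hθ⟩ := minimizers_zero_nonempty h₂
  refine le_antisymm ?_ (hexp.optRegret_nonneg le_rfl)
  rw [← hexp.regret_zero h₃ hθ]
  exact optRegret_le hθ.1

lemma lt_ofReal_of_coe_lt {T : ℝ≥0∞} {s : ℝ} (h : (T : EReal) < (s : EReal)) :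
    T < ENNReal.ofReal s := by
  rw [← EReal.coe_ennreal_lt_coe_ennreal_iff, EReal.coe_ennreal_ofReal]
  exact h.trans_le (EReal.coe_le_coe_iff.2 (le_max_left _ _))

lemma neg_or_ofReal_lt_of_lt_coe {T : ℝ≥0∞} {s : ℝ} (h : (s : EReal) < (T : EReal)) :
    s < 0 ∨ ENNReal.ofReal s < T := by
  refine (lt_or_ge s 0).imp_right fun hs => ?_
  rwa [← EReal.coe_ennreal_lt_coe_ennreal_iff, EReal.coe_ennreal_ofReal, max_eq_left hs]

lemma FirstOrderExpansion.eventually_le_regret (hexp : FirstOrderExpansion Θ Ξ p q P₀ ℓ)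
    (h₃ : MaximizersConverge Θ Ξ p P₀ ℓ) {θ β : F} (hθ : θ ∈ minimizers Θ Ξ p P₀ ℓ 0)
    (hβ : β ∈ minimizers Θ Ξ p P₀ ℓ 0) {s : ℝ}
    (hs : s < 0 ∨ ENNReal.ofReal s < gradDist Ξ q P₀ ℓ θ β) :
    ∀ᶠ δ in 𝓝[>] (0 : ℝ), ((s * δ : ℝ) : EReal) ≤ regret Θ Ξ p P₀ ℓ δ θ := by
  obtain ⟨r, hr, h⟩ := hexp.ge θ hθ.1 β hβ.1 s hs
  filter_upwards [Ioo_mem_nhdsGT hr] with δ hδ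
  have := (h θ hθ.1 (by simpa using hr) β hβ.1 (by simpa using hr) δ hδ.1 hδ.2).trans
    (le_regret θ hβ.1)
  rwa [le_antisymm (hexp.integral_le h₃ hθ hβ.1) (hexp.integral_le h₃ hβ hθ.1), sub_self,
    zero_add] at this

/-- The limit `β` of the maximizers dominates: a larger slope at `β₂` would force the regret above
the upper bound obtained from `β`, at some small radius. -/
lemma FirstOrderExpansion.iSup_gradDist_lt_top (hexp : FirstOrderExpansion Θ Ξ p q P₀ ℓ)
    (h₃ : MaximizersConverge Θ Ξ p P₀ ℓ) {θ : F} (hθ : θ ∈ minimizers Θ Ξ p P₀ ℓ 0) :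
    ⨆ β ∈ minimizers Θ Ξ p P₀ ℓ 0, gradDist Ξ q P₀ ℓ θ β < ⊤ := by
  obtain ⟨β, hβ, h⟩ := hexp.frequently_regret_le h₃ hθ (Q := fun _ => True)
    (Eventually.of_forall fun _ => trivial).frequently
  refine lt_of_le_of_lt (iSup₂_le fun β₂ hβ₂ => ?_) (hexp.gradDist_lt_top θ hθ.1 β hβ.1)
  by_contra! hlt
  obtain ⟨s₂, hs₂0, hs₂, hs₂'⟩ := ENNReal.lt_iff_exists_real_btwn.1 hlt
  obtain ⟨s₁, hs₁0, hs₁, hs₁'⟩ := ENNReal.lt_iff_exists_real_btwn.1 hs₂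
  obtain ⟨δ, ⟨hδ, -, β', hβ', hle⟩, hge⟩ := ((h s₁ hs₁).and_eventually
    (hexp.eventually_le_regret h₃ hθ hβ₂ (Or.inr hs₂'))).exists
  have h12 := (ENNReal.ofReal_lt_ofReal_iff_of_nonneg hs₁0).1 hs₁'
  have := EReal.coe_le_coe_iff.1 (hge.trans hle)
  have := mul_lt_mul_of_pos_right h12 hδ
  linarith [hexp.integral_le h₃ hθ hβ']

lemma le_div_coe {f : EReal} {s δ : ℝ} (hδ : 0 < δ) (h : ((s * δ : ℝ) : EReal) ≤ f) :
    (s : EReal) ≤ f / (δ : EReal) := by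
  rw [EReal.le_div_iff_mul_le (EReal.coe_pos.2 hδ) (EReal.coe_ne_top δ), ← EReal.coe_mul]
  exact h

lemma div_coe_le {f : EReal} {s δ : ℝ} (hδ : 0 < δ) (h : f ≤ ((s * δ : ℝ) : EReal)) :
    f / (δ : EReal) ≤ (s : EReal) := by
  rw [EReal.div_le_iff_le_mul (EReal.coe_pos.2 hδ) (EReal.coe_ne_top δ), ← EReal.coe_mul,
    mul_comm]
  exact h

lemma FirstOrderExpansion.eventually_regret_div_lt (hexp : FirstOrderExpansion Θ Ξ p q P₀ ℓ)
    (h₃ : MaximizersConverge Θ Ξ p P₀ ℓ) {θ : F} (hθ : θ ∈ minimizers Θ Ξ p P₀ ℓ 0)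
    {a : EReal}
    (ha : ((⨆ β ∈ minimizers Θ Ξ p P₀ ℓ 0, gradDist Ξ q P₀ ℓ θ β : ℝ≥0∞) : EReal) < a) :
    ∀ᶠ δ : ℝ in 𝓝[>] 0, regret Θ Ξ p P₀ ℓ δ θ / (δ : EReal) < a := by
  obtain ⟨s, hs, hsa⟩ := EReal.lt_iff_exists_real_btwn.1 ha
  by_contra hfreq
  obtain ⟨β, hβ, h⟩ := hexp.frequently_regret_le h₃ hθ (not_eventually.1 hfreq)
  obtain ⟨δ, hδ, hQ, β', hβ', hle⟩ := (h s
    ((le_iSup₂ (f := fun β (_ : β ∈ minimizers Θ Ξ p P₀ ℓ 0) => gradDist Ξ q P₀ ℓ θ β)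
      β hβ).trans_lt (lt_ofReal_of_coe_lt hs))).exists
  refine hQ ((div_coe_le hδ (hle.trans (EReal.coe_le_coe_iff.2 ?_))).trans_lt hsa)
  linarith [hexp.integral_le h₃ hθ hβ']

lemma FirstOrderExpansion.hasRightDerivAtZero_regret (hexp : FirstOrderExpansion Θ Ξ p q P₀ ℓ)
    (h₃ : MaximizersConverge Θ Ξ p P₀ ℓ) {θ : F} (hθ : θ ∈ minimizers Θ Ξ p P₀ ℓ 0) :
    HasRightDerivAtZero (fun δ => regret Θ Ξ p P₀ ℓ δ θ)
      ((⨆ β ∈ minimizers Θ Ξ p P₀ ℓ 0, gradDist Ξ q P₀ ℓ θ β : ℝ≥0∞) : EReal) := by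
  simp only [HasRightDerivAtZero, hexp.regret_zero h₃ hθ, sub_zero]
  refine tendsto_order.2 ⟨fun a ha => ?_, fun a ha => hexp.eventually_regret_div_lt h₃ hθ ha⟩
  obtain ⟨s, has, hs⟩ := EReal.lt_iff_exists_real_btwn.1 ha
  obtain ⟨β, hβ, hsβ⟩ : ∃ β ∈ minimizers Θ Ξ p P₀ ℓ 0,
      s < 0 ∨ ENNReal.ofReal s < gradDist Ξ q P₀ ℓ θ β := by
    rcases neg_or_ofReal_lt_of_lt_coe hs with h | h
    · exact ⟨θ, hθ, Or.inl h⟩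
    · simp only [lt_iSup_iff] at h
      obtain ⟨β, hβ, h⟩ := h
      exact ⟨β, hβ, Or.inr h⟩
  filter_upwards [hexp.eventually_le_regret h₃ hθ hβ hsβ, self_mem_nhdsWithin] with δ h hδ
  exact has.trans_le (le_div_coe hδ h)

/-- The lower bound extracts a limit of minimizers along radii where it fails; the upper bound only
needs `V ≤ R(·, θ)` for one nearly optimal ERM optimizer `θ`. -/
lemma FirstOrderExpansion.hasRightDerivAtZero_optRegret
    (hexp : FirstOrderExpansion Θ Ξ p q P₀ ℓ)
    (h₂ : MinimizersConverge Θ Ξ p P₀ ℓ) (h₃ : MaximizersConverge Θ Ξ p P₀ ℓ) :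
    HasRightDerivAtZero (optRegret Θ Ξ p P₀ ℓ)
      ((⨅ θ ∈ minimizers Θ Ξ p P₀ ℓ 0, ⨆ β ∈ minimizers Θ Ξ p P₀ ℓ 0,
        gradDist Ξ q P₀ ℓ θ β : ℝ≥0∞) : EReal) := by
  simp only [HasRightDerivAtZero, hexp.optRegret_zero h₂ h₃, sub_zero]
  refine tendsto_order.2 ⟨fun a ha => ?_, fun a ha => ?_⟩
  · obtain ⟨s, has, hs⟩ := EReal.lt_iff_exists_real_btwn.1 ha
    by_contra hfreq
    obtain ⟨θ, hθ, h⟩ := hexp.exists_le_optRegret h₂ (not_eventually.1 hfreq)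
    obtain ⟨β, hβ, hsβ⟩ : ∃ β ∈ minimizers Θ Ξ p P₀ ℓ 0,
        s < 0 ∨ ENNReal.ofReal s < gradDist Ξ q P₀ ℓ θ β := by
      rcases neg_or_ofReal_lt_of_lt_coe hs with h | h
      · exact ⟨θ, hθ, Or.inl h⟩
      · have h := h.trans_le (iInf₂_le θ hθ)
        simp only [lt_iSup_iff] at h
        obtain ⟨β, hβ, h⟩ := h
        exact ⟨β, hβ, Or.inr h⟩
    obtain ⟨δ, hδ, hQ, θ', hθ', hle⟩ := h β hβ s hsβ
    refine hQ (has.trans_le (le_div_coe hδ (le_trans (EReal.coe_le_coe_iff.2 ?_) hle)))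
    -- Optimality of `β` makes the zeroth-order term `𝔼[ℓ θ' - ℓ β]` nonnegative.
    linarith [hexp.integral_le h₃ hβ hθ']
  · obtain ⟨s, hs, hsa⟩ := EReal.lt_iff_exists_real_btwn.1 ha
    have hs' := lt_ofReal_of_coe_lt hs
    simp only [iInf_lt_iff] at hs'
    obtain ⟨θ, hθ, hs'⟩ := hs'
    have hθa : ((⨆ β ∈ minimizers Θ Ξ p P₀ ℓ 0, gradDist Ξ q P₀ ℓ θ β : ℝ≥0∞) : EReal) < a := by
      refine lt_of_le_of_lt ?_ hsa
      have hs0 : 0 ≤ s := (ENNReal.ofReal_pos.1 (zero_le.trans_lt hs')).le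
      have := EReal.coe_ennreal_le_coe_ennreal_iff.2 hs'.le
      rwa [EReal.coe_ennreal_ofReal, max_eq_left hs0] at this
    filter_upwards [hexp.eventually_regret_div_lt h₃ hθ hθa, self_mem_nhdsWithin] with δ h hδ
    exact (EReal.div_le_div_right_of_nonneg (EReal.coe_nonneg.2 (le_of_lt hδ))
      (optRegret_le hθ.1)).trans_lt h

end Regret

end WDRRO

theorem theorem3p3
    {E : Type*} [NormedAddCommGroup E] [NormedSpace ℝ E] [FiniteDimensional ℝ E]
    [MeasurableSpace E] [BorelSpace E]
    {F : Type*} [NormedAddCommGroup F] [NormedSpace ℝ F] [FiniteDimensional ℝ F]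
    (Θ : Set F) (hΘ_closed : IsClosed Θ) (hΘ_convex : Convex ℝ Θ)
    (Ξ : Set E) (hΞ_closed : IsClosed Ξ) (hΞ_convex : Convex ℝ Ξ)
    (p q : ℝ) (hp : 1 < p) (hq : q = p / (p - 1))
    (P₀ : Measure E) (hP₀ : P₀ ∈ WDRRO.ProbOn Ξ)
    (hP₀_moment : Integrable (fun x => ‖x‖ ^ p) P₀)
    (hP₀_frontier : P₀ (frontier Ξ) = 0)
    (ℓ : F → E → ℝ)
    (h₁ : WDRRO.SmoothLoss Θ Ξ p ℓ)
    (h₂ : WDRRO.MinimizersConverge Θ Ξ p P₀ ℓ)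
    (h₃ : WDRRO.MaximizersConverge Θ Ξ p P₀ ℓ) :
    -- the optimal regret: its right derivative exists, is finite, and is the inf-sup
    ((⨅ θ ∈ WDRRO.minimizers Θ Ξ p P₀ ℓ 0, ⨆ β ∈ WDRRO.minimizers Θ Ξ p P₀ ℓ 0,
        WDRRO.gradDist Ξ q P₀ ℓ θ β) < ⊤ ∧
      WDRRO.HasRightDerivAtZero (WDRRO.optRegret Θ Ξ p P₀ ℓ)
        ((⨅ θ ∈ WDRRO.minimizers Θ Ξ p P₀ ℓ 0, ⨆ β ∈ WDRRO.minimizers Θ Ξ p P₀ ℓ 0,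
          WDRRO.gradDist Ξ q P₀ ℓ θ β : ℝ≥0∞) : EReal)) ∧
    -- the regret of a fixed ERM policy
    (∀ θ ∈ WDRRO.minimizers Θ Ξ p P₀ ℓ 0,
      (⨆ β ∈ WDRRO.minimizers Θ Ξ p P₀ ℓ 0, WDRRO.gradDist Ξ q P₀ ℓ θ β) < ⊤ ∧
      WDRRO.HasRightDerivAtZero (fun δ => WDRRO.regret Θ Ξ p P₀ ℓ δ θ)
        ((⨆ β ∈ WDRRO.minimizers Θ Ξ p P₀ ℓ 0,
          WDRRO.gradDist Ξ q P₀ ℓ θ β : ℝ≥0∞) : EReal)) ∧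
    -- a unique ERM optimizer: both sensitivities vanish, and there is no first-order gain
    (∀ θ, WDRRO.minimizers Θ Ξ p P₀ ℓ 0 = {θ} →
      WDRRO.HasRightDerivAtZero (WDRRO.optRegret Θ Ξ p P₀ ℓ) 0 ∧
      WDRRO.HasRightDerivAtZero (fun δ => WDRRO.regret Θ Ξ p P₀ ℓ δ θ) 0 ∧
      Tendsto (fun δ : ℝ =>
          (WDRRO.regret Θ Ξ p P₀ ℓ δ θ - WDRRO.optRegret Θ Ξ p P₀ ℓ δ) / (δ : EReal))
        (𝓝[>] 0) (𝓝 0)) := by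
  have : ProperSpace E := FiniteDimensional.proper_real E
  have hp0 : 0 < p := by linarith
  have hpq : p.HolderConjugate q := (Real.holderConjugate_iff_eq_conjExponent hp).2 hq
  have hm : MemLp (fun x => x) (ENNReal.ofReal p) P₀ := by
    rw [← integrable_norm_rpow_iff (by fun_prop) (by simpa using hp0) ENNReal.ofReal_ne_top,
      ENNReal.toReal_ofReal hp0.le]
    exact hP₀_moment
  have hexp := WDRRO.firstOrderExpansion hpq hΞ_closed hΞ_convex hP₀ hm hP₀_frontier h₁
  have hV := hexp.hasRightDerivAtZero_optRegret h₂ h₃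
  refine ⟨⟨?_, hV⟩, fun θ hθ => ⟨hexp.iSup_gradDist_lt_top h₃ hθ,
    hexp.hasRightDerivAtZero_regret h₃ hθ⟩, fun θ hθ => ?_⟩
  · obtain ⟨θ, hθ⟩ := WDRRO.minimizers_zero_nonempty h₂
    exact (iInf₂_le θ hθ).trans_lt (hexp.iSup_gradDist_lt_top h₃ hθ)
  · have hθm : θ ∈ WDRRO.minimizers Θ Ξ p P₀ ℓ 0 := by rw [hθ]; rfl
    have hR := hexp.hasRightDerivAtZero_regret h₃ hθm
    have hq0 := hpq.symm.pos
    have h0 : WDRRO.gradDist Ξ q P₀ ℓ θ θ = 0 := by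
      have hz : ∀ x, ‖WDRRO.grad Ξ ℓ θ x - WDRRO.grad Ξ ℓ θ x‖ₑ = 0 := fun x => by
        rw [← ofReal_norm, sub_self, norm_zero, ENNReal.ofReal_zero]
      simp only [WDRRO.gradDist, hz, ENNReal.zero_rpow_of_pos hq0, lintegral_zero]
      exact ENNReal.zero_rpow_of_pos (one_div_pos.2 hq0)
    simp only [hθ, Set.mem_singleton_iff, iSup_iSup_eq_left, iInf_iInf_eq_left, h0,
      EReal.coe_ennreal_zero] at hV hR
    refine ⟨hV, hR, ?_⟩
    simp only [WDRRO.HasRightDerivAtZero, hexp.regret_zero h₃ hθm, sub_zero] at hR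
    -- Squeeze by `0 ≤ R - V ≤ R`. The left inequality needs `R < ⊤`, as `⊤ - ⊤ = ⊥` in `EReal`; it
    -- holds for small `δ` because `R / δ → 0`.
    refine tendsto_of_tendsto_of_tendsto_of_le_of_le' tendsto_const_nhds hR ?_ ?_
    · filter_upwards [hR.eventually_lt_const (u := ⊤) EReal.zero_lt_top,
        self_mem_nhdsWithin] with δ hδ hδ0
      refine EReal.div_nonneg ?_ (EReal.coe_nonneg.2 (le_of_lt hδ0))
      have hlt : WDRRO.regret Θ Ξ p P₀ ℓ δ θ < ⊤ := by
        rw [EReal.div_lt_iff (EReal.coe_pos.2 hδ0) (EReal.coe_ne_top δ),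
          EReal.top_mul_coe_of_pos hδ0] at hδ
        exact hδ
      have hle := WDRRO.optRegret_le (Ξ := Ξ) (p := p) (P₀ := P₀) (ℓ := ℓ) (δ := δ) hθm.1
      rw [EReal.sub_nonneg (Or.inl hlt.ne)
        (Or.inl (EReal.bot_lt_zero.trans_le (hexp.regret_nonneg hθm.1 (le_of_lt hδ0))).ne')]
      exact hle
    · filter_upwards [self_mem_nhdsWithin] with δ hδ0
      refine EReal.div_le_div_right_of_nonneg (EReal.coe_nonneg.2 (le_of_lt hδ0)) ?_
      have := EReal.sub_le_sub (le_refl (WDRRO.regret Θ Ξ p P₀ ℓ δ θ))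
        (hexp.optRegret_nonneg (le_of_lt hδ0))
      simpa using this
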